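/- Let $\mathfrak g$ be a finite-dimensional simple complex Lie algebra with Killing form $K$, $\mathfrak h$ a Cartan subalgebra, $R$ the set of roots, $\Gamma$ a set of simple roots, $\mathfrak g_\beta$ the root space of $\beta\in R$, and $\alpha_{\max}$ the highest root. Let $\alpha\in\Gamma$ and let $k$ be the coefficient of $\alpha$ in the decomposition of $\alpha_{\max}$ into simple roots. Put $a(u)=\frac1{1-u}=\sum_{n\ge0}u^n$ and equip the complex Lie algebra $\mathfrak g((u))\oplus\mathfrak g$ with the form $$Q_{a(u)}\big((f_1,x_1),(f_2,x_2)\big)=\mathrm{Res}_{u=0}\big(u^{-1}a(u)K(f_1,f_2)\big)-K(x_1,x_2),$$ where $K(f_1,f_2)$ is the Killing form of $\mathfrak g((u))$ over $\mathbb C((u))$, and $\mathfrak g\oplus\mathfrak g$ with the form $\bar Q((x_1,y_1),(x_2,y_2))=K(x_1,x_2)-K(y_1,y_2)$. A (complex) Lie subalgebra is called Lagrangian if it equals its orthogonal complement, and two subspaces are transversal if they intersect in $0$ and their sum is the whole space. The algebra $\mathfrak g[[u]]$ is regarded as a subalgebra of $\mathfrak g((u))\oplus\mathfrak g$ via $f\mapsto(f,f(0))$.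 Let $h\in\mathfrak h$ be the element with $\alpha(h)=1/k$ and $\gamma(h)=0$ for all $\gamma\in\Gamma\setminus\{\alpha\}$, let $v$ be the valuation on $\mathbb C((u^{-1}))$ with $v(\sum_{n\ge m}c_nu^{-n})=m$ if $c_m\neq0$, and let $$\mathbb O_\alpha=\mathfrak h[[u^{-1}]]\oplus\bigoplus_{\beta\in R}\{f\in\mathbb C((u^{-1})):v(f)\ge\beta(h)\}\otimes\mathfrak g_\beta .$$ Let $P_\alpha^-$ be the parabolic subalgebra spanned by $\mathfrak h$, the root spaces of all negative roots and those of all positive roots that do not contain $\alpha$. Its reductive part is spanned by $\mathfrak h$ and the root spaces of the roots not containing $\alpha$, and its nilpotent radical by the root spaces of the negative roots containing $\alpha$. Let $\Delta_\alpha$ be the set of pairs $(x,y)\in P_\alpha^-\times P_\alpha^-$ with the same reductive parts. (i) If $k=1$, then $$W\longmapsto\{(f(1),x):(f,x)\in W\}$$ is a bijection from the set of Lagrangian subalgebras $W$ of $\mathfrak g((u))\oplus\mathfrak g$, with respect to $Q_{a(u)}$, which are transversal to $\mathfrak g[[u]]$ and satisfy $W\subseteq(\mathbb O_\alpha\cap\mathfrak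 g[u,u^{-1}])\oplus\mathfrak g$, onto the set of Lagrangian subalgebras of $\mathfrak g\oplus\mathfrak g$, with respect to $\bar Q$, which are transversal to $\Delta_\alpha$. (ii) If $k>1$, there are no Lagrangian subalgebras $W$ of $\mathfrak g((u))\oplus\mathfrak g$, with respect to $Q_{a(u)}$, which are transversal to $\mathfrak g[[u]]$ and satisfy $W\subseteq(\mathbb O_\alpha\cap\mathfrak g[u,u^{-1}])\oplus\mathfrak g$. -/

import Mathlib

open scoped TensorProduct LaurentPolynomial PowerSeries
open LieAlgebra LieAlgebra.IsKilling

noncomputable section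

namespace PolyLie

/-! ### The highest root -/

section HighestRoot

open RootPairing

theorem eq_zero_of_mem_of_neg_mem {ι R M N : Type*} [Field R] [CharZero R]
    [AddCommGroup M] [Module R M] [AddCommGroup N] [Module R N]
    {P : RootPairing ι R M N} [P.IsRootSystem] (b : P.Base) {x : M}
    (hx : x ∈ AddSubmonoid.closure (P.root '' b.support))
    (hx' : -x ∈ AddSubmonoid.closure (P.root '' b.support)) : x = 0 := by
  let ht : M →ₗ[R] R := b.toWeightBasis.constr R (fun _ => (1 : R))
  have key : ∀ y ∈ AddSubmonoid.closure (P.root '' b.support),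
      ∃ n : ℕ, ht y = n ∧ (n = 0 → y = 0) := by
    intro y hy
    induction hy using AddSubmonoid.closure_induction with
    | mem y hy =>
      obtain ⟨i, hi, rfl⟩ := hy
      refine ⟨1, ?_, by simp⟩
      have := b.toWeightBasis.constr_basis R (fun _ => (1 : R)) ⟨i, hi⟩
      simpa [ht] using this
    | zero => exact ⟨0, by simp, by simp⟩
    | add y z _ _ h₁ h₂ =>
      obtain ⟨n, h1, h1'⟩ := h₁
      obtain ⟨m, h2, h2'⟩ := h₂
      refine ⟨n + m, by simp [h1, h2], fun h => ?_⟩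
      rw [h1' (by omega), h2' (by omega), add_zero]
  obtain ⟨n, h1, h1'⟩ := key _ hx
  obtain ⟨m, h2, -⟩ := key _ hx'
  rw [map_neg, h1] at h2
  have : ((n + m : ℕ) : R) = 0 := by push_cast; rw [← h2]; ring
  exact h1' (by have := Nat.cast_eq_zero.mp this; omega)

theorem exists_highest {ι R M N : Type*} [Field R] [CharZero R]
    [AddCommGroup M] [Module R M] [AddCommGroup N] [Module R N]
    {P : RootPairing ι R M N} [Finite ι] [Nonempty ι] [P.IsCrystallographic]
    [P.IsReduced] [P.IsIrreducible] (b : P.Base) :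
    ∃ t : ι, ∀ i, P.root t - P.root i ∈ AddSubmonoid.closure (P.root '' b.support) := by
  classical
  have : IsAddTorsionFree M := .of_isTorsionFree R M
  set Q := AddSubmonoid.closure (P.root '' b.support) with hQ
  have hsimple : ∀ i ∈ b.support, P.root i ∈ Q := fun i hi =>
    AddSubmonoid.subset_closure ⟨i, hi, rfl⟩
  let Max : ι → Prop := fun t => ∀ j, P.root j - P.root t ∈ Q → j = t
  have hsum : ∀ (t k : ι) (f : ι → ℕ), P.root t = ∑ j ∈ b.support, f j • P.root j →
      P.pairingIn ℤ t k = ∑ l ∈ b.support, (f l : ℤ) * P.pairingIn ℤ l k := by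
    intro t k f hf
    apply FaithfulSMul.algebraMap_injective ℤ R
    simp_rw [algebraMap_pairingIn, map_sum, ← root_coroot_eq_pairing, hf, map_sum, map_nsmul,
      LinearMap.coe_sum, Finset.sum_apply, LinearMap.smul_apply, root_coroot_eq_pairing, map_mul,
      algebraMap_pairingIn]
    simp
  have hD : ∀ i, ∃ t, Max t ∧ P.root t - P.root i ∈ Q := by
    intro i
    let r : ι → ι → Prop := fun j k => P.root j - P.root k ∈ Q ∧ j ≠ k
    have htrans : ∀ {x y z}, r x y → r y z → r x z := by
      rintro x y z ⟨h1, h1'⟩ ⟨h2, h2'⟩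
      refine ⟨by simpa using Q.add_mem h1 h2, ?_⟩
      rintro rfl
      have := eq_zero_of_mem_of_neg_mem b h1 (by simpa using h2)
      exact h1' (P.root.injective (sub_eq_zero.mp this))
    have : IsTrans ι r := ⟨fun _ _ _ h1 h2 => htrans h1 h2⟩
    have : Std.Irrefl r := ⟨fun x h => h.2 rfl⟩
    have hwf : WellFounded r := Finite.wellFounded_of_trans_of_irrefl r
    obtain ⟨t, ht, htm⟩ := hwf.has_min {t | P.root t - P.root i ∈ Q} ⟨i, by simp⟩
    refine ⟨t, fun j hj => ?_, ht⟩
    by_contra hne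
    exact htm j (by simpa using Q.add_mem hj ht) ⟨hj, hne⟩
  have hdom : ∀ t, Max t → ∀ i ∈ b.support, 0 ≤ P.pairingIn ℤ t i := by
    intro t ht i hi
    by_contra! hneg
    have hne : P.root t ≠ -P.root i := by
      intro h
      have := ht i (by rw [h, sub_neg_eq_add]; exact Q.add_mem (hsimple i hi) (hsimple i hi))
      subst this
      exact P.ne_zero i (self_eq_neg.mp h)
    obtain ⟨k, hk⟩ := P.root_add_root_mem_of_pairingIn_neg hneg hne
    have := ht k (by rw [hk]; simpa using hsimple i hi)
    subst this
    exact P.ne_zero i (by simpa using hk)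
  have hfull : ∀ t, Max t → ∃ f : ι → ℕ, P.root t = ∑ j ∈ b.support, f j • P.root j ∧
      ∀ j ∈ b.support, 0 < f j := by
    intro t ht
    obtain ⟨f, hf0, hf⟩ := b.exists_root_eq_sum_nat_or_neg t
    have hfQ : ∑ j ∈ b.support, f j • P.root j ∈ Q :=
      Q.sum_mem fun j hj => Q.nsmul_mem (hsimple j hj) _
    have hf' : P.root t = ∑ j ∈ b.support, f j • P.root j := by
      refine hf.resolve_right fun h => ?_
      have hm : -P.root t ∈ Q := by rw [h, neg_neg]; exact hfQ
      have h2 := ht (P.reflectionPerm t t) (by simpa [sub_eq_add_neg] using Q.add_mem hm hm)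
      have h3 : P.root (P.reflectionPerm t t) = P.root t := by rw [h2]
      simp only [root_reflectionPerm, reflection_apply_self] at h3
      exact P.ne_zero t (self_eq_neg.mp h3.symm)
    refine ⟨f, hf', ?_⟩
    obtain ⟨i0, hi0, hpos⟩ : ∃ i ∈ b.support, 0 < f i := by
      by_contra! hall
      refine P.ne_zero t ?_
      rw [hf']
      exact Finset.sum_eq_zero fun j hj => by
        have := hall j hj
        simp [Nat.le_zero.mp this]
    intro j hj
    have := b.induction_on_cartanMatrix (fun k => 0 < f k) (i := ⟨i0, hi0⟩) (j := ⟨j, hj⟩) hpos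
    refine this ?_
    rintro ⟨i, hi⟩ ⟨k, hk⟩ hpi hik
    by_contra hfk
    have hfk : f k = 0 := by simpa using hfk
    have hik' : b.cartanMatrix ⟨i, hi⟩ ⟨k, hk⟩ ≠ 0 := by
      rwa [ne_eq, b.cartanMatrix_apply_eq_zero_iff_symm]
    have hne : i ≠ k := by rintro rfl; simp only at hpi; omega
    have hle : ∀ l ∈ b.support, (f l : ℤ) * P.pairingIn ℤ l k ≤ 0 := by
      intro l hl
      by_cases hlk : l = k
      · simp [hlk, hfk]
      · exact mul_nonpos_of_nonneg_of_nonpos (by positivity) (b.pairingIn_le_zero_of_ne hlk hl hk)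
    have hlt : (f i : ℤ) * P.pairingIn ℤ i k < 0 := by
      have h1 := b.pairingIn_le_zero_of_ne hne hi hk
      have h2 : P.pairingIn ℤ i k ≠ 0 := hik'
      have : P.pairingIn ℤ i k < 0 := lt_of_le_of_ne h1 h2
      exact mul_neg_of_pos_of_neg (by simpa using hpi) this
    have := hdom t ht k hk
    have h3 := Finset.sum_lt_sum (f := fun l => (f l : ℤ) * P.pairingIn ℤ l k) (g := fun _ => 0)
      hle ⟨i, hi, hlt⟩
    rw [hsum t k f hf'] at this
    simp only [Finset.sum_const_zero] at h3
    omega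
  have huniq : ∀ t t', Max t → Max t' → t' = t := by
    intro t t' ht ht'
    obtain ⟨g, hg, hg0⟩ := hfull t' ht'
    by_contra hne
    have hnn : ∀ j ∈ b.support, 0 ≤ P.pairingIn ℤ j t := fun j hj => by
      have := hdom t ht j hj
      by_contra! h
      have : P.pairingIn ℤ t j < 0 := by
        simpa using (P.pairingIn_lt_zero_iff (S := ℤ)).mp h
      omega
    have hpos : 0 < P.pairingIn ℤ t' t := by
      obtain ⟨f, hf, -⟩ := hfull t ht
      obtain ⟨j, hj, hj0⟩ : ∃ j ∈ b.support, 0 < P.pairingIn ℤ j t := by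
        by_contra! hall
        have h2 : P.pairingIn ℤ t t ≤ 0 := by
          rw [hsum t t f hf]
          exact Finset.sum_nonpos fun j hj =>
            mul_nonpos_of_nonneg_of_nonpos (by positivity) (hall j hj)
        simp at h2
      rw [hsum t' t g hg]
      refine Finset.sum_pos' (fun l hl => mul_nonneg (by positivity) (hnn l hl)) ⟨j, hj, ?_⟩
      exact mul_pos (by exact_mod_cast hg0 j hj) hj0
    obtain ⟨k, hk⟩ := P.root_sub_root_mem_of_pairingIn_pos hpos hne
    rcases b.root_mem_or_neg_mem k with h | h
    · exact hne (ht t' (by rwa [hk] at h))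
    · exact hne (ht' t (by rwa [hk, neg_sub] at h)).symm
  obtain ⟨i⟩ := (inferInstance : Nonempty ι)
  obtain ⟨t, ht, -⟩ := hD i
  refine ⟨t, fun j => ?_⟩
  obtain ⟨t', ht', h⟩ := hD j
  rwa [huniq t t' ht ht'] at h
end HighestRoot

section Roots

variable {g : Type*} [LieRing g] [LieAlgebra ℂ g] [FiniteDimensional ℂ g] [IsSimple ℂ g]
  {H : LieSubalgebra ℂ g} [H.IsCartanSubalgebra]

theorem nonempty_root (H : LieSubalgebra ℂ g) [H.IsCartanSubalgebra] : Nonempty H.root := by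
  by_contra h
  rw [not_nonempty_iff] at h
  have hn : Nontrivial (Module.Dual ℂ H) := RootPairing.IsIrreducible.nontrivial (rootSystem H)
  have hs := RootPairing.IsRootSystem.span_root_eq_top (P := rootSystem H)
  rw [Set.range_eq_empty, Submodule.span_empty] at hs
  exact bot_ne_top hs

theorem exists_highestRoot (b : (rootSystem H).Base) :
    ∃ t : H.root, ∀ β : H.root, (rootSystem H).root t - (rootSystem H).root β ∈
      AddSubmonoid.closure ((rootSystem H).root '' b.support) :=
  haveI := nonempty_root H
  exists_highest b

/-- The highest root `α_max`: the root such that `α_max - β` is a sum of simple roots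
for every root `β`. -/
def highestRoot (b : (rootSystem H).Base) : H.root :=
  Classical.choose (exists_highestRoot b)

/-- The coefficient of the simple root `α` in the decomposition of the root `β` into simple
roots. -/
def rootCoeff (b : (rootSystem H).Base) (α : b.support) (β : H.root) : ℤ :=
  b.toWeightBasisInt.repr ((rootSystem H).rootSpanMem ℤ β) α

/-- The coefficient `k` of the simple root `α` in `α_max`. -/
def highestCoeff (b : (rootSystem H).Base) (α : b.support) : ℤ :=
  rootCoeff b α (highestRoot b)

/-- The vertex of the standard simplex which corresponds to the simple root `α`: the point `h`
of the Cartan subalgebra with `α(h) = 1 / k` and `β(h) = 0` for the other simple roots `β`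
(see `apply_vertex`). It is the fundamental coweight of `α` divided by `k`. -/
def vertex (b : (rootSystem H).Base) (α : b.support) : H :=
  ((highestCoeff b α : ℂ))⁻¹ • (Module.evalEquiv ℂ H).symm (b.toWeightBasis.coord α)

theorem apply_vertex (b : (rootSystem H).Base) (α β : b.support)
    [Decidable (β = α)] :
    (rootSystem H).root β (vertex b α) = if β = α then (highestCoeff b α : ℂ)⁻¹ else 0 := by
  have h : (rootSystem H).root β ((Module.evalEquiv ℂ H).symm (b.toWeightBasis.coord α)) =
      b.toWeightBasis.coord α ((rootSystem H).root β) := by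
    simp only [Module.apply_evalEquiv_symm_apply]
  rw [vertex, map_smul, h, Module.Basis.coord_apply, b.toWeightBasis_repr_root]
  simp [Finsupp.single_apply]

/-- The reductive part of the parabolic subalgebra `P_α⁻`: the sum of the Cartan subalgebra and of
the root spaces of all roots which do not contain `α`. -/
def reductivePart (b : (rootSystem H).Base) (α : b.support) : Submodule ℂ g :=
  H.toSubmodule ⊔ ⨆ β : {β : H.root // rootCoeff b α β = 0}, (rootSpace H β.1.1).toSubmodule

/-- The nilpotent radical of the parabolic subalgebra `P_α⁻`: the sum of the root spaces of all
negative roots which contain `α`. -/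
def nilpotentPart (b : (rootSystem H).Base) (α : b.support) : Submodule ℂ g :=
  ⨆ β : {β : H.root // ¬ b.IsPos β ∧ rootCoeff b α β ≠ 0}, (rootSpace H β.1.1).toSubmodule

/-- The standard parabolic subalgebra `P_α⁻`: the sum of the Cartan subalgebra, of the root spaces
of all negative roots, and of the root spaces of all positive roots which do not contain `α`. -/
def parabolic (b : (rootSystem H).Base) (α : b.support) : Submodule ℂ g :=
  H.toSubmodule ⊔ ⨆ β : {β : H.root // ¬ b.IsPos β ∨ (b.IsPos β ∧ rootCoeff b α β = 0)},
    (rootSpace H β.1.1).toSubmodule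

/-- `Δ_α`: the set of pairs `(x, y)` in `P_α⁻ × P_α⁻` with equal reductive parts. -/
def deltaSet (b : (rootSystem H).Base) (α : b.support) : Submodule ℂ (g × g) where
  carrier := {p | p.1 ∈ parabolic b α ∧ p.2 ∈ parabolic b α ∧
    ∃ l ∈ reductivePart b α, p.1 - l ∈ nilpotentPart b α ∧ p.2 - l ∈ nilpotentPart b α}
  add_mem' := by
    rintro p q ⟨h1, h2, l, hl, h3, h4⟩ ⟨h1', h2', l', hl', h3', h4'⟩
    refine ⟨add_mem h1 h1', add_mem h2 h2', l + l', add_mem hl hl', ?_, ?_⟩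
    · simpa [add_sub_add_comm] using add_mem h3 h3'
    · simpa [add_sub_add_comm] using add_mem h4 h4'
  zero_mem' := ⟨zero_mem _, zero_mem _, 0, zero_mem _, by simp, by simp⟩
  smul_mem' := by
    rintro c p ⟨h1, h2, l, hl, h3, h4⟩
    refine ⟨Submodule.smul_mem _ c h1, Submodule.smul_mem _ c h2, c • l,
      Submodule.smul_mem _ c hl, ?_, ?_⟩
    · simpa [smul_sub] using Submodule.smul_mem _ c h3
    · simpa [smul_sub] using Submodule.smul_mem _ c h4

end Roots

/-! ### Loop algebras

`ℂ((u))` is `LaurentSeries ℂ`, and for finite-dimensional `g` the Lie algebra `g((u))` is the base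
change `ℂ((u)) ⊗ g`. The field `ℂ((u⁻¹))` is again `LaurentSeries ℂ`, its variable being read as
`u⁻¹`; so `f.coeff n` is then the coefficient of `u⁻ⁿ`. -/

attribute [instance 2000] HahnSeries.instAlgebra

/-- The variable of the field of Laurent series, as a unit. -/
def laurentVar : (LaurentSeries ℂ)ˣ where
  val := HahnSeries.single 1 1
  inv := HahnSeries.single (-1) 1
  val_inv := by simp
  inv_val := by simp

/-- Evaluation of Laurent polynomials at a unit `t` of a commutative algebra. -/
def laurentEval {A : Type*} [CommRing A] [Algebra ℂ A] (t : Aˣ) : ℂ[T;T⁻¹] →ₐ[ℂ] A :=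
  { LaurentPolynomial.eval₂ (algebraMap ℂ A) t with
    commutes' := fun c => LaurentPolynomial.eval₂_C (algebraMap ℂ A) t c }

section Loops

variable (g : Type*) [LieRing g] [LieAlgebra ℂ g]

/-- The identification `ℂ ⊗ g ≃ g`, as a homomorphism of Lie algebras. -/
def lidLie : ℂ ⊗[ℂ] g →ₗ⁅ℂ⁆ g :=
  { (TensorProduct.lid ℂ g).toLinearMap with
    map_lie' := by
      intro x y
      obtain ⟨x, rfl⟩ := (TensorProduct.lid ℂ g).symm.surjective x
      obtain ⟨y, rfl⟩ := (TensorProduct.lid ℂ g).symm.surjective y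
      simp }

/-- The inclusion of `g[u, u⁻¹] ⊕ g` into `g((u)) ⊕ g`. -/
def inclLoop : (ℂ[T;T⁻¹] ⊗[ℂ] g) × g →ₗ⁅ℂ⁆ (LaurentSeries ℂ ⊗[ℂ] g) × g :=
  (ExtendScalars.map (laurentEval laurentVar) (LieHom.id : g →ₗ⁅ℂ⁆ g)).prodMap LieHom.id

/-- The homomorphism `(f, x) ↦ (f(1), x)` from `g[u, u⁻¹] ⊕ g` to `g ⊕ g`. -/
def evalOne : (ℂ[T;T⁻¹] ⊗[ℂ] g) × g →ₗ⁅ℂ⁆ g × g :=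
  ((lidLie g).comp (ExtendScalars.map (laurentEval 1) (LieHom.id : g →ₗ⁅ℂ⁆ g))).prodMap LieHom.id

/-- The subspace `{(f(1), x) | (f, x) ∈ W, f ∈ g[u, u⁻¹]}` of `g ⊕ g`, which is a subalgebra. -/
def specialize (W : LieSubalgebra ℂ ((LaurentSeries ℂ ⊗[ℂ] g) × g)) : LieSubalgebra ℂ (g × g) :=
  (W.comap (inclLoop g)).map (evalOne g)

/-- The copy `{(f, f(0)) | f ∈ g[[u]]}` of `g[[u]]` in `g((u)) ⊕ g`. -/
def powerSeriesPart : Submodule ℂ ((LaurentSeries ℂ ⊗[ℂ] g) × g) :=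
  LinearMap.range (LinearMap.prod
    (LinearMap.rTensor g (HahnSeries.ofPowerSeriesAlg ℤ ℂ).toLinearMap)
    ((TensorProduct.lid ℂ g).toLinearMap ∘ₗ LinearMap.rTensor g (PowerSeries.coeff 0)))

theorem coeff_algebraMap_mul (c : ℂ) (f : LaurentSeries ℂ) (n : ℤ) :
    (algebraMap ℂ (LaurentSeries ℂ) c * f).coeff n = c * f.coeff n := by
  rw [HahnSeries.algebraMap_apply, HahnSeries.C_mul_eq_smul]
  simp

/-- The form `Q_a` on `g((u)) ⊕ g`, for a power series `a`, namely
`Q_a((f₁, x₁), (f₂, x₂)) = Res_{u = 0} (u⁻¹ a(u) K(f₁, f₂)) - K(x₁, x₂)`, where the first `K` is the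
Killing form of `g((u))` over `ℂ((u))`. -/
def formQ (a : ℂ⟦X⟧) : LinearMap.BilinForm ℂ ((LaurentSeries ℂ ⊗[ℂ] g) × g) :=
  LinearMap.mk₂ ℂ
    (fun p q => ((laurentVar⁻¹ : (LaurentSeries ℂ)ˣ) * (a : LaurentSeries ℂ) *
      killingForm (LaurentSeries ℂ) (LaurentSeries ℂ ⊗[ℂ] g) p.1 q.1).coeff (-1) -
        killingForm ℂ g p.2 q.2)
    (fun p p' q => by
      simp only [Prod.fst_add, Prod.snd_add, map_add, LinearMap.add_apply, mul_add,
        HahnSeries.coeff_add]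
      ring)
    (fun c p q => by
      rw [Prod.smul_fst, Prod.smul_snd, ← algebraMap_smul (LaurentSeries ℂ) c p.1, map_smul,
        LinearMap.smul_apply, smul_eq_mul, mul_left_comm, coeff_algebraMap_mul, map_smul,
        LinearMap.smul_apply, smul_eq_mul, smul_eq_mul, mul_sub])
    (fun p q q' => by
      simp only [Prod.fst_add, Prod.snd_add, map_add, mul_add,
        HahnSeries.coeff_add]
      ring)
    (fun c p q => by
      rw [Prod.smul_fst, Prod.smul_snd, ← algebraMap_smul (LaurentSeries ℂ) c q.1, map_smul,
        smul_eq_mul, mul_left_comm, coeff_algebraMap_mul, map_smul, smul_eq_mul, smul_eq_mul,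
        mul_sub])

/-- The form `Q̄((x₁, y₁), (x₂, y₂)) = K(x₁, x₂) - K(y₁, y₂)` on `g ⊕ g`. -/
def formQbar : LinearMap.BilinForm ℂ (g × g) :=
  (killingForm ℂ g).comp (LinearMap.fst ℂ g g) (LinearMap.fst ℂ g g) -
    (killingForm ℂ g).comp (LinearMap.snd ℂ g g) (LinearMap.snd ℂ g g)

end Loops

/-- A subalgebra is Lagrangian for a (symmetric) form if it equals its orthogonal complement. -/
def IsLagrangian {L : Type*} [LieRing L] [LieAlgebra ℂ L] (B : LinearMap.BilinForm ℂ L)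
    (W : LieSubalgebra ℂ L) : Prop :=
  B.orthogonal W.toSubmodule = W.toSubmodule

/-! ### Maximal orders -/

/-- `{f ∈ ℂ((u⁻¹)) : v(f) ≥ r}`, where `v(∑_{n ≥ m} cₙ u⁻ⁿ) = m` if `cₘ ≠ 0`. -/
def valGE (r : ℝ) : Submodule ℂ (LaurentSeries ℂ) where
  carrier := {f | ∀ n : ℤ, (n : ℝ) < r → f.coeff n = 0}
  add_mem' := fun hf hg n hn => by simp [hf n hn, hg n hn]
  zero_mem' := fun n _ => by simp
  smul_mem' := fun c f hf n hn => by simp [hf n hn]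

/-- For subspaces `M` of `A` and `V` of `g`, the subspace `M ⊗ V` of `A ⊗ g`. -/
def tensorSub {A g : Type*} [AddCommGroup A] [Module ℂ A] [AddCommGroup g] [Module ℂ g]
    (M : Submodule ℂ A) (V : Submodule ℂ g) : Submodule ℂ (A ⊗[ℂ] g) :=
  Submodule.span ℂ {z | ∃ f ∈ M, ∃ x ∈ V, f ⊗ₜ[ℂ] x = z}

section Orders

variable {g : Type*} [LieRing g] [LieAlgebra ℂ g] [FiniteDimensional ℂ g] [IsSimple ℂ g]
  {H : LieSubalgebra ℂ g} [H.IsCartanSubalgebra]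

/-- For `h` in the real form `h(ℝ)` of the Cartan subalgebra (so that all `β(h)` are real), the
order `𝕆_h = h[[u⁻¹]] ⊕ ⨁_β M_β(h) ⊗ g_β` in `g((u⁻¹))`, where `M_β(h) = {f : v(f) ≥ β(h)}`. -/
def maxOrder (h : H) : Submodule ℂ (LaurentSeries ℂ ⊗[ℂ] g) :=
  tensorSub (valGE 0) H.toSubmodule ⊔
    ⨆ β : H.root, tensorSub (valGE ((rootSystem H).root β h).re) (rootSpace H β.1).toSubmodule

/-- `𝕆_α ∩ g[u, u⁻¹]`, as a subspace of `g((u))`: the Laurent polynomials with coefficients in `g`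
whose image in `g((u⁻¹))` lies in `𝕆_α`. -/
def orderLaurent (b : (rootSystem H).Base) (α : b.support) :
    Submodule ℂ (LaurentSeries ℂ ⊗[ℂ] g) :=
  ((maxOrder (vertex b α)).comap
      (LinearMap.rTensor g (laurentEval laurentVar⁻¹).toLinearMap)).map
    (LinearMap.rTensor g (laurentEval laurentVar).toLinearMap)

/-- The Lagrangian subalgebras `W` of `g((u)) ⊕ g` with respect to `Q_a`, transversal to `g[[u]]`
and contained in `(𝕆_α ∩ g[u, u⁻¹]) ⊕ g`. -/
def loopLagrangians (a : ℂ⟦X⟧) (b : (rootSystem H).Base) (α : b.support) :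
    Set (LieSubalgebra ℂ ((LaurentSeries ℂ ⊗[ℂ] g) × g)) :=
  {W | IsLagrangian (formQ g a) W ∧ IsCompl W.toSubmodule (powerSeriesPart g) ∧
    W.toSubmodule ≤ (orderLaurent b α).prod ⊤}

/-- The Lagrangian subalgebras of `g ⊕ g` with respect to `Q̄`, transversal to `Δ_α`. -/
def finiteLagrangians (b : (rootSystem H).Base) (α : b.support) :
    Set (LieSubalgebra ℂ (g × g)) :=
  {W | IsLagrangian (formQbar g) W ∧ IsCompl W.toSubmodule (deltaSet b α)}

end Orders

end PolyLie

end

open scoped TensorProduct LaurentPolynomial PowerSeries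
open LieAlgebra LieAlgebra.IsKilling

noncomputable section

namespace PolyLie

/-! ### Coefficients of elements of `g((u))` and `g[u, u⁻¹]`. -/

section LoopCoefficients

/-! Let S = (𝕆_α ∩ g[u, u⁻¹]) ⊕ g, and let c_β ∈ [-k, k] be the coefficient of α in the root β.
Since uⁿ has valuation -n in ℂ((u⁻¹)), a root vector of β may occur in degree n of S exactly when
c_β ≤ -nk.

Case k = 1. Let P be the parabolic subalgebra and N its nilpotent radical. The coefficients allowed
in degree n form F_n = g, P, N, 0 for n < 0, n = 0, n = 1, n ≥ 2. This filtration is multiplicative,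
and F_{1-n} is the Killing-orthogonal of F_n. All coefficients of a(u) are 1, so Q_a(uⁿx, uᵐy) =
K(x, y) if n + m ≤ 0; if n + m > 0 and x ∈ F_n, y ∈ F_m, both sides vanish. Hence on S the form Q_a
is the pullback of Q̄ along e : (f, x) ↦ (f(1), x) (`formQ_inclLoop`). The factor 1 - u cancels
a(u), so pairing with (u^{1-n} - u^{-n})x, an element of ker e, isolates the coefficient of uⁿ;
therefore whatever is orthogonal to S ∩ ker e lies in S (`exists_inclLoop_eq_of_orthogonal`). Thus S
is coisotropic with quotient g ⊕ g, and Lagrangian reduction (`bijOn_lagrangian_reduction`) gives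
the bijection. Transversality is carried along because S + g[[u]] is everything and S ∩ g[[u]] = {(x
+ uy, x) : x ∈ P, y ∈ N} is mapped by e isomorphically onto Δ_α.

Case k > 1 (`loopLagrangians_eq_empty`). For a root vector e of α, the element (1 - u⁻¹)e pairs only
with degree 1 of g_{-α}, which S does not meet. So it is orthogonal to W ⊆ S and hence lies in W;
but its constant term e is not allowed in S. -/

theorem laurentVar_zpow (n : ℤ) :
    ((laurentVar ^ n : (LaurentSeries ℂ)ˣ) : LaurentSeries ℂ) = HahnSeries.single n 1 := by
  have hpow : ∀ m : ℕ, ((laurentVar ^ m : (LaurentSeries ℂ)ˣ) : LaurentSeries ℂ) =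
      HahnSeries.single (m : ℤ) 1 := by
    intro m
    rw [Units.val_pow_eq_pow_val]
    change (HahnSeries.single (1 : ℤ) (1 : ℂ)) ^ m = _
    simp
  obtain ⟨m, rfl | rfl⟩ := n.eq_nat_or_neg
  · rw [zpow_natCast, hpow]
  · rw [zpow_neg, zpow_natCast]
    refine Units.inv_eq_of_mul_eq_one_right ?_
    rw [hpow, HahnSeries.single_mul_single]
    simp

theorem laurentEval_T {A : Type*} [CommRing A] [Algebra ℂ A] (t : Aˣ) (n : ℤ) :
    laurentEval t (LaurentPolynomial.T n) = ((t ^ n : Aˣ) : A) :=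
  LaurentPolynomial.eval₂_T (algebraMap ℂ A) t n

theorem laurentEval_laurentVar_T (n : ℤ) :
    laurentEval laurentVar (LaurentPolynomial.T n) = HahnSeries.single n 1 := by
  rw [laurentEval_T, laurentVar_zpow]

theorem laurentEval_laurentVar_inv_T (n : ℤ) :
    laurentEval laurentVar⁻¹ (LaurentPolynomial.T n) = HahnSeries.single (-n) 1 := by
  rw [laurentEval_T, inv_zpow', laurentVar_zpow]

theorem laurentPolynomial_tensor_induction {V : Type*} [AddCommGroup V] [Module ℂ V]
    {p : ℂ[T;T⁻¹] ⊗[ℂ] V → Prop} (z : ℂ[T;T⁻¹] ⊗[ℂ] V) (h0 : p 0)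
    (hT : ∀ (n : ℤ) (x : V), p (LaurentPolynomial.T n ⊗ₜ x))
    (hadd : ∀ y z, p y → p z → p (y + z)) : p z := by
  induction z using TensorProduct.induction_on with
  | zero => exact h0
  | add y z hy hz => exact hadd y z hy hz
  | tmul f x =>
    induction f using LaurentPolynomial.induction_on' with
    | add f f' hf hf' => rw [TensorProduct.add_tmul]; exact hadd _ _ hf hf'
    | C_mul_T n a =>
      rw [← LaurentPolynomial.smul_eq_C_mul, TensorProduct.smul_tmul]
      exact hT n (a • x)

variable (g : Type*) [AddCommGroup g] [Module ℂ g]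

/-- The coefficient of `uⁿ` of an element of `ℂ((u)) ⊗ g`. -/
def loopCoeff (n : ℤ) : LaurentSeries ℂ ⊗[ℂ] g →ₗ[ℂ] g :=
  (TensorProduct.lid ℂ g).toLinearMap ∘ₗ
    LinearMap.rTensor g (HahnSeries.coeff.linearMap (R := ℂ) n)

variable {g}

@[simp]
theorem loopCoeff_tmul (n : ℤ) (f : LaurentSeries ℂ) (x : g) :
    loopCoeff g n (f ⊗ₜ x) = f.coeff n • x := rfl

theorem loopCoeff_single_tmul (n m : ℤ) (x : g) :
    loopCoeff g n (HahnSeries.single m (1 : ℂ) ⊗ₜ x) = if n = m then x else 0 := by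
  rw [loopCoeff_tmul, HahnSeries.coeff_single]
  split_ifs <;> simp

/-- In a basis of `g` extended to ℂ((u)), the coordinates of `z` are Laurent series whose
coefficients are the coordinates of the `loopCoeff g n z`. -/
theorem eq_zero_of_loopCoeff_eq_zero [FiniteDimensional ℂ g] {z : LaurentSeries ℂ ⊗[ℂ] g}
    (hz : ∀ n, loopCoeff g n z = 0) : z = 0 := by
  let b := Module.finBasis ℂ g
  let B := Algebra.TensorProduct.basis (LaurentSeries ℂ) b
  have key : ∀ (z : LaurentSeries ℂ ⊗[ℂ] g) (n : ℤ) i,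
      (B.repr z i).coeff n = b.repr (loopCoeff g n z) i := by
    intro z n i
    induction z using TensorProduct.induction_on with
    | zero => simp
    | add y z hy hz => simp [hy, hz]
    | tmul f x =>
      rw [Algebra.TensorProduct.basis_repr_tmul, loopCoeff_tmul]
      simp only [Finsupp.smul_apply, Finsupp.mapRange_apply, smul_eq_mul, map_smul]
      rw [mul_comm, coeff_algebraMap_mul, mul_comm]
  apply B.repr.injective
  ext i n
  simp [key, hz]

theorem ext_loopCoeff [FiniteDimensional ℂ g] {y z : LaurentSeries ℂ ⊗[ℂ] g}
    (h : ∀ n, loopCoeff g n y = loopCoeff g n z) : y = z := by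
  rw [← sub_eq_zero]
  exact eq_zero_of_loopCoeff_eq_zero fun n => by rw [map_sub, h, sub_self]

/-- One Laurent polynomial is embedded both in ℂ((u)) and in ℂ((u⁻¹)), with exponents mirrored. This
lets the order condition, posed in ℂ((u⁻¹)), be read in degrees of u. -/
theorem loopCoeff_laurentVar_inv (n : ℤ) (z : ℂ[T;T⁻¹] ⊗[ℂ] g) :
    loopCoeff g n (LinearMap.rTensor g (laurentEval laurentVar⁻¹).toLinearMap z) =
      loopCoeff g (-n) (LinearMap.rTensor g (laurentEval laurentVar).toLinearMap z) := by
  induction z using laurentPolynomial_tensor_induction with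
  | h0 => simp
  | hadd y z hy hz => simp [hy, hz]
  | hT m x =>
    simp only [LinearMap.rTensor_tmul, AlgHom.toLinearMap_apply, laurentEval_laurentVar_T,
      laurentEval_laurentVar_inv_T, loopCoeff_single_tmul]
    simp only [eq_neg_iff_add_eq_zero, neg_eq_iff_add_eq_zero]

/-- Allowing every finite set containing the support makes the induction pass through sums: two
supports are enlarged to their union. -/
theorem exists_eq_sum_T_tmul (z : ℂ[T;T⁻¹] ⊗[ℂ] g) :
    ∃ s : Finset ℤ, ∀ t, s ⊆ t → z = ∑ n ∈ t, LaurentPolynomial.T n ⊗ₜ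
      loopCoeff g n (LinearMap.rTensor g (laurentEval laurentVar).toLinearMap z) := by
  classical
  induction z using laurentPolynomial_tensor_induction with
  | h0 => exact ⟨∅, fun t _ => by simp⟩
  | hadd y z hy hz =>
    obtain ⟨s, hs⟩ := hy
    obtain ⟨s', hs'⟩ := hz
    refine ⟨s ∪ s', fun t ht => ?_⟩
    simp only [map_add, TensorProduct.tmul_add, Finset.sum_add_distrib]
    rw [← hs t (Finset.union_subset_left ht), ← hs' t (Finset.union_subset_right ht)]
  | hT m x =>
    refine ⟨{m}, fun t ht => ?_⟩
    simp only [LinearMap.rTensor_tmul, AlgHom.toLinearMap_apply, laurentEval_laurentVar_T,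
      loopCoeff_single_tmul]
    rw [Finset.sum_eq_single m (by intro n _ h; simp [h]) fun h => (h (ht (by simp))).elim]
    simp

/-- Every Laurent series is the sum of a Laurent polynomial with negative exponents and a power
series; here after tensoring with `g`. -/
theorem exists_eq_polynomial_add_powerSeries (z : LaurentSeries ℂ ⊗[ℂ] g) :
    ∃ (w : ℂ[T;T⁻¹] ⊗[ℂ] g) (p : ℂ⟦X⟧ ⊗[ℂ] g),
      z = LinearMap.rTensor g (laurentEval laurentVar).toLinearMap w +
        LinearMap.rTensor g (HahnSeries.ofPowerSeriesAlg ℤ ℂ).toLinearMap p ∧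
      ∀ n, 0 ≤ n → loopCoeff g n
        (LinearMap.rTensor g (laurentEval laurentVar).toLinearMap w) = 0 := by
  induction z using TensorProduct.induction_on with
  | zero => exact ⟨0, 0, by simp, by simp⟩
  | add y z hy hz =>
    obtain ⟨w, p, h, h0⟩ := hy
    obtain ⟨w', p', h', h0'⟩ := hz
    refine ⟨w + w', p + p', ?_, fun n hn => by simp [h0 n hn, h0' n hn]⟩
    rw [h, h', map_add, map_add]
    abel
  | tmul f x =>
    obtain ⟨N, hN⟩ : ∃ N : ℤ, ∀ n < N, f.coeff n = 0 :=
      ⟨f.order, fun n hn => HahnSeries.coeff_eq_zero_of_lt_order hn⟩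
    refine ⟨(∑ n ∈ Finset.Ico N 0, f.coeff n • LaurentPolynomial.T n) ⊗ₜ x,
      (PowerSeries.mk fun n => f.coeff (n : ℤ)) ⊗ₜ x, ?_, ?_⟩
    · simp only [LinearMap.rTensor_tmul, ← TensorProduct.add_tmul]
      congr 1
      ext n
      simp only [AlgHom.toLinearMap_apply, map_sum, map_smul, laurentEval_laurentVar_T,
        HahnSeries.coeff_add, HahnSeries.coeff_sum, HahnSeries.coeff_smul,
        HahnSeries.coeff_single]
      have hp : (HahnSeries.ofPowerSeriesAlg ℤ ℂ (PowerSeries.mk fun n => f.coeff (n : ℤ))).coeff n =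
          if n < 0 then 0 else f.coeff n := by
        change (HahnSeries.ofPowerSeries ℤ ℂ (PowerSeries.mk fun n => f.coeff (n : ℤ))).coeff n = _
        rw [PowerSeries.coeff_coe, PowerSeries.coeff_mk]
        split_ifs with h
        · rfl
        · rw [Int.natAbs_of_nonneg (by omega)]
      rw [hp]
      simp only [smul_eq_mul, mul_ite, mul_one, mul_zero, Finset.sum_ite_eq, Finset.mem_Ico]
      split_ifs with h1 h2 h2
      · simp
      · omega
      · simp [hN n (by omega)]
      · simp
    · intro n hn
      simp only [LinearMap.rTensor_tmul, AlgHom.toLinearMap_apply, map_sum, map_smul,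
        laurentEval_laurentVar_T, loopCoeff_tmul, HahnSeries.coeff_sum, HahnSeries.coeff_smul,
        HahnSeries.coeff_single]
      rw [Finset.sum_eq_zero, zero_smul]
      intro m hm
      rw [if_neg, smul_zero]
      have := (Finset.mem_Ico.mp hm).2
      omega

end LoopCoefficients

/-! ### The form `Q_a` for a(u) = 1/(1 - u). -/

section Form

variable {g : Type*} [LieRing g] [LieAlgebra ℂ g]

theorem killingForm_laurent_tmul [FiniteDimensional ℂ g] (f f' : LaurentSeries ℂ) (x x' : g) :
    killingForm (LaurentSeries ℂ) (LaurentSeries ℂ ⊗[ℂ] g) (f ⊗ₜ x) (f' ⊗ₜ x') =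
      algebraMap ℂ (LaurentSeries ℂ) (killingForm ℂ g x x') * (f * f') := by
  rw [killingForm, LieModule.traceForm_baseChange, LinearMap.BilinForm.baseChange_tmul,
    ← Algebra.smul_def]

theorem formQ_apply (a : ℂ⟦X⟧) (p q : (LaurentSeries ℂ ⊗[ℂ] g) × g) :
    formQ g a p q = ((laurentVar⁻¹ : (LaurentSeries ℂ)ˣ) * (a : LaurentSeries ℂ) *
      killingForm (LaurentSeries ℂ) (LaurentSeries ℂ ⊗[ℂ] g) p.1 q.1).coeff (-1) -
        killingForm ℂ g p.2 q.2 := rfl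

theorem formQbar_apply (p q : g × g) :
    formQbar g p q = killingForm ℂ g p.1 q.1 - killingForm ℂ g p.2 q.2 := rfl

theorem laurentVar_inv_val :
    ((laurentVar⁻¹ : (LaurentSeries ℂ)ˣ) : LaurentSeries ℂ) = HahnSeries.single (-1) 1 := rfl

theorem geom_coe_mul :
    (((1 - PowerSeries.X)⁻¹ : ℂ⟦X⟧) : LaurentSeries ℂ) * (1 - HahnSeries.single 1 1) = 1 := by
  have h : (1 - PowerSeries.X : ℂ⟦X⟧)⁻¹ * (1 - PowerSeries.X) = 1 :=
    PowerSeries.inv_mul_cancel _ (by simp)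
  have := congrArg (HahnSeries.ofPowerSeries ℤ ℂ) h
  rwa [map_mul, map_sub, map_one, HahnSeries.ofPowerSeries_X] at this

theorem geom_coe_coeff (n : ℤ) (hn : 0 ≤ n) :
    (((1 - PowerSeries.X)⁻¹ : ℂ⟦X⟧) : LaurentSeries ℂ).coeff n = 1 := by
  have h : (1 - PowerSeries.X : ℂ⟦X⟧)⁻¹ = PowerSeries.mk 1 := by
    rw [PowerSeries.inv_eq_iff_mul_eq_one (by simp)]
    exact PowerSeries.mk_one_mul_one_sub_eq_one ℂ
  lift n to ℕ using hn
  rw [LaurentSeries.coeff_coe_powerSeries, h]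
  simp

/-- The residue picks the coefficient of a(u) in degree -(n + m) ≥ 0, which is 1; the exponents
leave no trace. -/
theorem formQ_geom_single [FiniteDimensional ℂ g] (n m : ℤ) (h : n + m ≤ 0) (x y x₀ y₀ : g) :
    formQ g (1 - PowerSeries.X)⁻¹ (HahnSeries.single n (1 : ℂ) ⊗ₜ x, x₀)
      (HahnSeries.single m (1 : ℂ) ⊗ₜ y, y₀) = killingForm ℂ g x y - killingForm ℂ g x₀ y₀ := by
  rw [formQ_apply, killingForm_laurent_tmul, laurentVar_inv_val, mul_assoc,
    HahnSeries.coeff_single_mul, mul_left_comm, coeff_algebraMap_mul,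
    HahnSeries.single_mul_single, HahnSeries.coeff_mul_single, geom_coe_coeff _ (by omega)]
  simp

/-- Since uⁿ - uⁿ⁻¹ = -(1 - u)uⁿ⁻¹, the factor a(u) cancels and the residue sees a single
coefficient of `y`. Both cases of the theorem use such elements as coefficient detectors. -/
theorem formQ_geom_sub_single [FiniteDimensional ℂ g] (n : ℤ) (x y₀ : g)
    (y : LaurentSeries ℂ ⊗[ℂ] g) :
    formQ g (1 - PowerSeries.X)⁻¹
      ((HahnSeries.single n (1 : ℂ) - HahnSeries.single (n - 1) (1 : ℂ)) ⊗ₜ x, 0) (y, y₀) =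
        - killingForm ℂ g x (loopCoeff g (1 - n) y) := by
  have h1 : (HahnSeries.single n (1 : ℂ) - HahnSeries.single (n - 1) (1 : ℂ) : LaurentSeries ℂ) =
      (1 - HahnSeries.single 1 1) * HahnSeries.single (n - 1) (-1) := by
    rw [sub_mul, HahnSeries.single_mul_single]
    simp [add_comm, sub_eq_add_neg]
  have h2 : (((1 - PowerSeries.X)⁻¹ : ℂ⟦X⟧) : LaurentSeries ℂ) *
      (HahnSeries.single n (1 : ℂ) - HahnSeries.single (n - 1) (1 : ℂ)) =
        HahnSeries.single (n - 1) (-1) := by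
    rw [h1, ← mul_assoc, geom_coe_mul, one_mul]
  rw [formQ_apply]
  simp only [map_zero, LinearMap.zero_apply, sub_zero]
  induction y using TensorProduct.induction_on with
  | zero => simp
  | add y z hy hz => simp only [map_add, mul_add, HahnSeries.coeff_add, hy, hz]; ring
  | tmul f y =>
    rw [killingForm_laurent_tmul, laurentVar_inv_val, mul_assoc, mul_left_comm _ (algebraMap _ _ _),
      ← mul_assoc _ _ f, h2, HahnSeries.coeff_single_mul, coeff_algebraMap_mul,
      HahnSeries.coeff_single_mul, loopCoeff_tmul, map_smul]
    have : (-1 - -1 - (n - 1) : ℤ) = 1 - n := by ring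
    rw [this]
    simp
    ring

end Form

/-! ### The coefficient of α in a root. -/

section RootCoefficients

open RootPairing

variable {g : Type*} [LieRing g] [LieAlgebra ℂ g] [FiniteDimensional ℂ g] [IsSimple ℂ g]
  {H : LieSubalgebra ℂ g} [H.IsCartanSubalgebra]
  (b : (rootSystem H).Base) (α : b.support)

theorem root_eq_sum_rootCoeff (β : H.root) :
    (rootSystem H).root β = ∑ j : b.support, rootCoeff b j β • (rootSystem H).root j := by
  have h := b.toWeightBasisInt.sum_repr ((rootSystem H).rootSpanMem ℤ β)
  have h' := congrArg (Subtype.val) h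
  rw [AddSubmonoidClass.coe_finsetSum] at h'
  simpa [rootCoeff] using h'.symm

theorem coord_root (β : H.root) :
    b.toWeightBasis.coord α ((rootSystem H).root β) = (rootCoeff b α β : ℂ) := by
  classical
  rw [root_eq_sum_rootCoeff b β, map_sum, Finset.sum_eq_single α]
  · rw [map_zsmul, Module.Basis.coord_apply, b.toWeightBasis_repr_root]
    simp
  · intro j _ hj
    rw [map_zsmul, Module.Basis.coord_apply, b.toWeightBasis_repr_root]
    simp [hj]
  · simp

theorem root_apply_vertex (β : H.root) :
    (rootSystem H).root β (vertex b α) = (rootCoeff b α β : ℂ) / highestCoeff b α := by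
  rw [vertex, map_smul, Module.apply_evalEquiv_symm_apply, coord_root, smul_eq_mul]
  ring

theorem exists_nat_coord_of_mem_closure {x : Module.Dual ℂ H}
    (hx : x ∈ AddSubmonoid.closure ((rootSystem H).root '' b.support)) :
    ∃ n : ℕ, b.toWeightBasis.coord α x = n := by
  classical
  induction hx using AddSubmonoid.closure_induction with
  | mem y hy =>
    obtain ⟨i, hi, rfl⟩ := hy
    rw [Module.Basis.coord_apply, b.toWeightBasis_repr_root ⟨i, hi⟩, Finsupp.single_apply]
    split_ifs
    exacts [⟨1, by simp⟩, ⟨0, by simp⟩]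
  | zero => exact ⟨0, by simp⟩
  | add y z _ _ h₁ h₂ =>
    obtain ⟨n, hn⟩ := h₁
    obtain ⟨m, hm⟩ := h₂
    exact ⟨n + m, by rw [map_add, hn, hm]; push_cast; rfl⟩

theorem rootCoeff_le_highestCoeff (β : H.root) : rootCoeff b α β ≤ highestCoeff b α := by
  obtain ⟨n, hn⟩ := exists_nat_coord_of_mem_closure b α
    (Classical.choose_spec (exists_highestRoot b) β)
  rw [map_sub, coord_root, coord_root] at hn
  have : rootCoeff b α (highestRoot b) - rootCoeff b α β = (n : ℤ) := by
    rw [highestRoot]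
    exact_mod_cast hn
  rw [highestCoeff]
  omega

theorem exists_neg_root (β : H.root) : ∃ γ : H.root,
    (rootSystem H).root γ = -(rootSystem H).root β ∧ rootCoeff b α γ = -rootCoeff b α β ∧
      (b.IsPos γ ↔ ¬ b.IsPos β) := by
  let := (rootSystem H).indexNeg
  have h : (rootSystem H).root (-β) = -(rootSystem H).root β := by
    rw [indexNeg_neg, root_reflectionPerm, reflection_apply_self]
  refine ⟨-β, h, ?_, RootPairing.Base.IsPos.neg_iff_not b β⟩
  have := coord_root b α (-β)
  rw [h, map_neg, coord_root] at this
  exact_mod_cast this.symm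

theorem neg_highestCoeff_le_rootCoeff (β : H.root) : -highestCoeff b α ≤ rootCoeff b α β := by
  obtain ⟨γ, -, h, -⟩ := exists_neg_root b α β
  have := rootCoeff_le_highestCoeff b α γ
  omega

theorem rootCoeff_nonneg_of_isPos {β : H.root} (h : b.IsPos β) : 0 ≤ rootCoeff b α β := by
  have hmem : (rootSystem H).root β ∈ AddSubmonoid.closure ((rootSystem H).root '' b.support) := by
    refine h.induction_on_add (p := fun i => (rootSystem H).root i ∈
      AddSubmonoid.closure ((rootSystem H).root '' b.support)) (fun i hi => AddSubmonoid.subset_closure ⟨i, hi, rfl⟩) ?_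
    intro i j k hk hi hj
    rw [hk]
    exact add_mem hi (AddSubmonoid.subset_closure ⟨j, hj, rfl⟩)
  obtain ⟨n, hn⟩ := exists_nat_coord_of_mem_closure b α hmem
  rw [coord_root] at hn
  have : rootCoeff b α β = (n : ℤ) := by exact_mod_cast hn
  omega

theorem rootCoeff_nonpos_of_not_isPos {β : H.root} (h : ¬ b.IsPos β) : rootCoeff b α β ≤ 0 := by
  obtain ⟨γ, -, hγ, hpos⟩ := exists_neg_root b α β
  have := rootCoeff_nonneg_of_isPos b α (hpos.mpr h)
  omega

theorem rootCoeff_self : rootCoeff b α α = 1 := by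
  have := coord_root b α α
  rw [Module.Basis.coord_apply, b.toWeightBasis_repr_root] at this
  simpa using this.symm

end RootCoefficients

/-! ### Root spaces and the Killing form. -/

section RootSpaces

variable {g : Type*} [LieRing g] [LieAlgebra ℂ g] [FiniteDimensional ℂ g] [IsSimple ℂ g]
  {H : LieSubalgebra ℂ g} [H.IsCartanSubalgebra]

omit [IsSimple ℂ g] in
theorem cartan_sup_iSup_rootSpace (H : LieSubalgebra ℂ g) [H.IsCartanSubalgebra] :
    H.toSubmodule ⊔ ⨆ β : H.root, (rootSpace H β.1).toSubmodule = ⊤ := by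
  rw [eq_top_iff, ← LieSubmodule.iSup_toSubmodule_eq_top.mpr
    (LieModule.iSup_genWeightSpace_eq_top' ℂ H g)]
  refine iSup_le fun χ => ?_
  by_cases hχ : χ.IsZero
  · refine le_sup_of_le_left ?_
    intro x hx
    have h0 : (χ : H → ℂ) = 0 := hχ
    rw [h0] at hx
    exact (rootSpace_zero_eq ℂ g H).le hx
  · exact le_sup_of_le_right
      (le_iSup (fun β : H.root => (rootSpace H β.1).toSubmodule) ⟨χ, by simpa using hχ⟩)

theorem killingForm_rootSpace_eq_zero {β γ : H.root}
    (h : (rootSystem H).root γ ≠ -(rootSystem H).root β) {x y : g} (hx : x ∈ rootSpace H β.1)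
    (hy : y ∈ rootSpace H γ.1) : killingForm ℂ g x y = 0 := by
  refine killingForm_apply_eq_zero_of_mem_rootSpace_of_add_ne_zero ℂ g H hx hy fun h0 => h ?_
  rw [eq_neg_iff_add_eq_zero, add_comm]
  ext t
  exact congrFun h0 t

omit [IsSimple ℂ g] in
theorem mem_rootSpace_zero {x : g} (hx : x ∈ H) : x ∈ rootSpace H (0 : H → ℂ) := by
  rw [rootSpace_zero_eq ℂ g H]
  exact hx

omit [IsSimple ℂ g] in
theorem killingForm_rootSpace_cartan {β : H.root} {x y : g} (hx : x ∈ rootSpace H β.1)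
    (hy : y ∈ H) : killingForm ℂ g x y = 0 := by
  refine killingForm_apply_eq_zero_of_mem_rootSpace_of_add_ne_zero ℂ g H hx
    (mem_rootSpace_zero hy) fun h0 => ?_
  have hβ := β.2
  rw [add_zero] at h0
  simp only [LieSubalgebra.root, Finset.mem_filter] at hβ
  exact hβ.2 h0

end RootSpaces

/-! ### Degrees of elements of the order. -/

section MaxOrder

variable {g : Type*} [LieRing g] [LieAlgebra ℂ g] [FiniteDimensional ℂ g] [IsSimple ℂ g]
  {H : LieSubalgebra ℂ g} [H.IsCartanSubalgebra]

/-- A summand with threshold r reaches degree n only if r ≤ n. The subspace `V` is left free: it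
will be the kernel of a functional when k > 1 and a filtration step when k = 1. -/
theorem loopCoeff_mem_of_mem_maxOrder {h : H} {V : Submodule ℂ g} {n : ℤ}
    (hH : 0 ≤ n → H.toSubmodule ≤ V)
    (hβ : ∀ β : H.root, ((rootSystem H).root β h).re ≤ n → (rootSpace H β.1).toSubmodule ≤ V)
    {z : LaurentSeries ℂ ⊗[ℂ] g} (hz : z ∈ maxOrder h) : loopCoeff g n z ∈ V := by
  have key : ∀ (r : ℝ) (S : Submodule ℂ g), (r ≤ n → S ≤ V) →
      tensorSub (valGE r) S ≤ V.comap (loopCoeff g n) := by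
    intro r S hS
    refine Submodule.span_le.mpr ?_
    rintro _ ⟨f, hf, x, hx, rfl⟩
    rw [SetLike.mem_coe, Submodule.mem_comap, loopCoeff_tmul]
    by_cases hr : r ≤ n
    · exact V.smul_mem _ (hS hr hx)
    · rw [hf n (not_le.mp hr), zero_smul]
      exact V.zero_mem
  have hle : maxOrder h ≤ V.comap (loopCoeff g n) :=
    sup_le (key 0 _ fun h0 => hH (by exact_mod_cast h0)) (iSup_le fun β => key _ _ (hβ β))
  exact hle hz

theorem single_mem_valGE {r : ℝ} {n : ℤ} (h : r ≤ n) : HahnSeries.single n (1 : ℂ) ∈ valGE r := by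
  intro m hm
  rw [HahnSeries.coeff_single, if_neg]
  rintro rfl
  exact absurd h (not_le.mpr hm)

theorem single_tmul_mem_maxOrder_of_mem_cartan {h : H} {n : ℤ} (hn : 0 ≤ n) {x : g} (hx : x ∈ H) :
    HahnSeries.single n (1 : ℂ) ⊗ₜ x ∈ maxOrder h :=
  Submodule.mem_sup_left <| Submodule.subset_span
    ⟨_, single_mem_valGE (by exact_mod_cast hn), x, hx, rfl⟩

theorem single_tmul_mem_maxOrder_of_mem_rootSpace {h : H} {n : ℤ} {β : H.root}
    (hn : ((rootSystem H).root β h).re ≤ n) {x : g} (hx : x ∈ rootSpace H β.1) :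
    HahnSeries.single n (1 : ℂ) ⊗ₜ x ∈ maxOrder h :=
  Submodule.mem_sup_right <| Submodule.mem_iSup_of_mem β <| Submodule.subset_span
    ⟨_, single_mem_valGE hn, x, hx, rfl⟩

end MaxOrder

theorem killingForm_comm {g : Type*} [LieRing g] [LieAlgebra ℂ g] (x y : g) :
    killingForm ℂ g x y = killingForm ℂ g y x :=
  LieModule.traceForm_comm ℂ g g x y

theorem formQ_comm {g : Type*} [LieRing g] [LieAlgebra ℂ g] (a : ℂ⟦X⟧)
    (p q : (LaurentSeries ℂ ⊗[ℂ] g) × g) : formQ g a p q = formQ g a q p := by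
  rw [formQ_apply, formQ_apply, killingForm_comm p.2, killingForm,
    LieModule.traceForm_comm (LaurentSeries ℂ) _ _ p.1]

/-! ### The case k > 1. -/

section OrderLaurent

variable {g : Type*} [LieRing g] [LieAlgebra ℂ g] [FiniteDimensional ℂ g] [IsSimple ℂ g]
  {H : LieSubalgebra ℂ g} [H.IsCartanSubalgebra]
  (b : (rootSystem H).Base) (α : b.support)

theorem re_root_apply_vertex (β : H.root) :
    ((rootSystem H).root β (vertex b α)).re = (rootCoeff b α β : ℝ) / highestCoeff b α := by
  rw [root_apply_vertex]
  have : (rootCoeff b α β : ℂ) / highestCoeff b α =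
      (((rootCoeff b α β : ℝ) / highestCoeff b α : ℝ) : ℂ) := by push_cast; rfl
  rw [this, Complex.ofReal_re]

theorem loopCoeff_mem_of_mem_comap_maxOrder (hk : 0 < highestCoeff b α) {V : Submodule ℂ g} {n : ℤ}
    (hH : n ≤ 0 → H.toSubmodule ≤ V)
    (hβ : ∀ β : H.root, rootCoeff b α β ≤ -n * highestCoeff b α →
      (rootSpace H β.1).toSubmodule ≤ V)
    {z : ℂ[T;T⁻¹] ⊗[ℂ] g}
    (hz : LinearMap.rTensor g (laurentEval laurentVar⁻¹).toLinearMap z ∈ maxOrder (vertex b α)) :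
    loopCoeff g n (LinearMap.rTensor g (laurentEval laurentVar).toLinearMap z) ∈ V := by
  rw [← neg_neg n, ← loopCoeff_laurentVar_inv]
  refine loopCoeff_mem_of_mem_maxOrder (fun h => hH (by omega)) (fun β h => hβ β ?_) hz
  rw [re_root_apply_vertex, div_le_iff₀ (by exact_mod_cast hk)] at h
  exact_mod_cast h

/-- A root vector of β orthogonal to g_{-β} would lie in the radical of the Killing form, which is
zero. -/
theorem exists_killingForm_rootSpace_ne_zero (β γ : H.root)
    (h : (rootSystem H).root γ = -(rootSystem H).root β) :
    ∃ x ∈ rootSpace H β.1, ∃ y ∈ rootSpace H γ.1, killingForm ℂ g x y ≠ 0 := by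
  obtain ⟨x, hx, hx0⟩ := β.1.exists_ne_zero
  refine ⟨x, hx, ?_⟩
  by_contra! hall
  have hneg : (-β.1 : H → ℂ) = γ.1 := by
    ext t
    exact (LinearMap.congr_fun h t).symm
  have := mem_ker_killingForm_of_mem_rootSpace_of_forall_rootSpace_neg ℂ g H hx
    (fun y hy => hall y (by rwa [hneg] at hy))
  rw [LieAlgebra.IsKilling.ker_killingForm_eq_bot] at this
  exact hx0 this

theorem loopLagrangians_eq_empty (hk : 1 < highestCoeff b α) :
    loopLagrangians (1 - PowerSeries.X)⁻¹ b α = ∅ := by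
  refine Set.eq_empty_of_forall_notMem ?_
  rintro W ⟨hW, -, hle⟩
  obtain ⟨γ, hγ, hcγ, -⟩ := exists_neg_root b α α
  rw [rootCoeff_self] at hcγ
  obtain ⟨e, he, f, hf, hef⟩ := exists_killingForm_rootSpace_ne_zero _ _ hγ
  have hsymm : (rootSystem H).root α = -(rootSystem H).root γ := by rw [hγ, neg_neg]
  -- The element (1 - u⁻¹)e detects the g_{-α}-part of degree 1. That part vanishes on the order, as
  -- it would need -1 ≤ -k; so the element is orthogonal to W.
  have hmem : ((HahnSeries.single 0 (1 : ℂ) - HahnSeries.single (0 - 1) (1 : ℂ)) ⊗ₜ e, 0) ∈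
      W.toSubmodule := by
    rw [← hW]
    intro w hw
    obtain ⟨z, hz, hzw⟩ := (hle hw).1
    change formQ g _ w _ = 0
    rw [formQ_comm]
    rw [show w = (w.1, w.2) from rfl, formQ_geom_sub_single, neg_eq_zero, ← LinearMap.mem_ker,
      ← hzw]
    refine loopCoeff_mem_of_mem_comap_maxOrder b α (by omega) (fun h => by omega) ?_ hz
    intro β hβ y hy
    rw [LinearMap.mem_ker]
    refine killingForm_rootSpace_eq_zero (fun h => ?_) he hy
    have : β = γ := (rootSystem H).root.injective (h.trans hγ.symm)
    subst this
    rw [hcγ] at hβ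
    omega
  obtain ⟨z, hz, hze⟩ := (hle hmem).1
  -- In degree 0 the order has no g_α-part, as this would need 1 ≤ 0; so K(f, ·) kills every
  -- constant term, contradicting K(e, f) ≠ 0.
  have h0 : loopCoeff g 0 (LinearMap.rTensor g (laurentEval laurentVar).toLinearMap z) ∈
      LinearMap.ker (killingForm ℂ g f) := by
    refine loopCoeff_mem_of_mem_comap_maxOrder b α (by omega) (fun _ y hy => ?_) ?_ hz
    · exact killingForm_rootSpace_cartan hf hy
    · intro β hβ y hy
      refine killingForm_rootSpace_eq_zero (fun h => ?_) hf hy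
      have : β = α := (rootSystem H).root.injective (h.trans hsymm.symm)
      subst this
      rw [rootCoeff_self] at hβ
      omega
  rw [hze, TensorProduct.sub_tmul, map_sub, loopCoeff_single_tmul, loopCoeff_single_tmul,
    if_pos rfl, if_neg (by omega), sub_zero, LinearMap.mem_ker, killingForm_comm] at h0
  exact hef h0

end OrderLaurent

/-! ### For k = 1: the grading by the vertex, the parabolic subalgebra and `Δ_α`. -/

section Parabolic

variable {g : Type*} [LieRing g] [LieAlgebra ℂ g] [FiniteDimensional ℂ g] [IsSimple ℂ g]
  {H : LieSubalgebra ℂ g} [H.IsCartanSubalgebra]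
  {b : (rootSystem H).Base} {α : b.support}

omit [FiniteDimensional ℂ g] [IsSimple ℂ g] in
-- Invariance of the Killing form under ad d gives (r + s) K(x, y) = 0.
theorem killingForm_eq_zero_of_lie_eq_smul {d x y : g} {r s : ℂ} (hx : ⁅d, x⁆ = r • x)
    (hy : ⁅d, y⁆ = s • y) (h : r + s ≠ 0) : killingForm ℂ g x y = 0 := by
  have := LieModule.traceForm_apply_lie_apply' ℂ g g d x y
  rw [hx, hy, map_smul, map_smul, LinearMap.smul_apply, smul_eq_mul, smul_eq_mul] at this
  have h0 : (r + s) * killingForm ℂ g x y = 0 := by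
    rw [add_mul]
    exact eq_neg_iff_add_eq_zero.mp this
  exact (mul_eq_zero.mp h0).resolve_left h

variable (b α) in
/-- The eigenspace of the adjoint action of the vertex of `α` with eigenvalue `c`. -/
def vertexEigenspace (c : ℂ) : Submodule ℂ g :=
  Module.End.eigenspace (LieAlgebra.ad ℂ g (vertex b α : g)) c

theorem mem_vertexEigenspace {c : ℂ} {x : g} :
    x ∈ vertexEigenspace b α c ↔ ⁅(vertex b α : g), x⁆ = c • x := by
  rw [vertexEigenspace, Module.End.mem_eigenspace_iff, LieAlgebra.ad_apply]

theorem killingForm_vertexEigenspace {r s : ℂ} (h : r + s ≠ 0) {x y : g}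
    (hx : x ∈ vertexEigenspace b α r) (hy : y ∈ vertexEigenspace b α s) :
    killingForm ℂ g x y = 0 :=
  killingForm_eq_zero_of_lie_eq_smul (mem_vertexEigenspace.mp hx) (mem_vertexEigenspace.mp hy) h

theorem lie_mem_vertexEigenspace {r s : ℂ} {x y : g}
    (hx : x ∈ vertexEigenspace b α r) (hy : y ∈ vertexEigenspace b α s) :
    ⁅x, y⁆ ∈ vertexEigenspace b α (r + s) := by
  rw [mem_vertexEigenspace] at *
  rw [leibniz_lie, hx, hy, smul_lie, lie_smul, add_smul]

theorem cartan_le_vertexEigenspace : H.toSubmodule ≤ vertexEigenspace b α 0 := by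
  intro x hx
  rw [mem_vertexEigenspace]
  exact lie_eq_smul_of_mem_rootSpace (mem_rootSpace_zero hx) (vertex b α)

theorem rootSpace_le_vertexEigenspace (hk : highestCoeff b α = 1) (β : H.root) :
    (rootSpace H β.1).toSubmodule ≤ vertexEigenspace b α (rootCoeff b α β) := by
  intro x hx
  rw [mem_vertexEigenspace]
  have h := lie_eq_smul_of_mem_rootSpace hx (vertex b α)
  have h' := root_apply_vertex b α β
  rw [hk, Int.cast_one, div_one] at h'
  rw [← h']
  exact h

theorem reductivePart_le_vertexEigenspace (hk : highestCoeff b α = 1) :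
    reductivePart b α ≤ vertexEigenspace b α 0 := by
  refine sup_le cartan_le_vertexEigenspace (iSup_le fun β => ?_)
  have := rootSpace_le_vertexEigenspace hk β.1
  rwa [β.2, Int.cast_zero] at this

theorem nilpotentPart_le_vertexEigenspace (hk : highestCoeff b α = 1) :
    nilpotentPart b α ≤ vertexEigenspace b α (-1) := by
  refine iSup_le fun β => ?_
  have h := rootSpace_le_vertexEigenspace hk β.1
  have h1 := rootCoeff_nonpos_of_not_isPos b α β.2.1
  have h2 := neg_highestCoeff_le_rootCoeff b α β.1
  have h3 : rootCoeff b α β.1 = -1 := by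
    have := β.2.2
    omega
  rw [h3] at h
  exact_mod_cast h

theorem parabolic_eq : parabolic b α = reductivePart b α ⊔ nilpotentPart b α := by
  apply le_antisymm
  · refine sup_le (le_sup_of_le_left le_sup_left) (iSup_le fun β => ?_)
    by_cases h : rootCoeff b α β.1 = 0
    · exact le_sup_of_le_left (le_sup_of_le_right (le_iSup
        (fun β : {β : H.root // rootCoeff b α β = 0} => (rootSpace H β.1.1).toSubmodule) ⟨β.1, h⟩))
    · refine le_sup_of_le_right (le_iSup (fun β : {β : H.root // ¬ b.IsPos β ∧ rootCoeff b α β ≠ 0}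
        => (rootSpace H β.1.1).toSubmodule) ⟨β.1, ?_, h⟩)
      exact β.2.resolve_right fun h' => h h'.2
  · have hle : ∀ β : H.root, (¬ b.IsPos β ∨ (b.IsPos β ∧ rootCoeff b α β = 0)) →
        (rootSpace H β.1).toSubmodule ≤ parabolic b α := fun β hβ =>
      le_sup_of_le_right (le_iSup
        (fun β : {β : H.root // ¬ b.IsPos β ∨ (b.IsPos β ∧ rootCoeff b α β = 0)} =>
          (rootSpace H β.1.1).toSubmodule) ⟨β, hβ⟩)
    refine sup_le (sup_le le_sup_left (iSup_le fun β => hle β.1 ?_))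
      (iSup_le fun β => hle β.1 (Or.inl β.2.1))
    by_cases h : b.IsPos β.1
    · exact Or.inr ⟨h, β.2⟩
    · exact Or.inl h

theorem reductivePart_le_parabolic : reductivePart b α ≤ parabolic b α :=
  parabolic_eq (b := b) ▸ le_sup_left

theorem nilpotentPart_le_parabolic : nilpotentPart b α ≤ parabolic b α :=
  parabolic_eq (b := b) ▸ le_sup_right

theorem cartan_le_parabolic : H.toSubmodule ≤ parabolic b α := le_sup_left

theorem rootSpace_le_parabolic {β : H.root} (h : rootCoeff b α β ≤ 0) :
    (rootSpace H β.1).toSubmodule ≤ parabolic b α := by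
  refine le_sup_of_le_right (le_iSup
    (fun β : {β : H.root // ¬ b.IsPos β ∨ (b.IsPos β ∧ rootCoeff b α β = 0)} =>
      (rootSpace H β.1.1).toSubmodule) ⟨β, ?_⟩)
  by_cases hβ : b.IsPos β
  · exact Or.inr ⟨hβ, le_antisymm h (rootCoeff_nonneg_of_isPos b α hβ)⟩
  · exact Or.inl hβ

theorem rootSpace_le_nilpotentPart {β : H.root} (h : rootCoeff b α β < 0) :
    (rootSpace H β.1).toSubmodule ≤ nilpotentPart b α := by
  refine le_iSup (fun β : {β : H.root // ¬ b.IsPos β ∧ rootCoeff b α β ≠ 0}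
        => (rootSpace H β.1.1).toSubmodule) ⟨β, ?_, h.ne⟩
  intro hβ
  exact absurd (rootCoeff_nonneg_of_isPos b α hβ) (not_le.mpr h)

/-- For k = 1 the coefficient of α in a root is -1, 0 or 1, so the vertex grades `g` in these three
degrees; only degree 1 lies outside the parabolic. -/
theorem exists_eq_add_of_highestCoeff_eq_one (hk : highestCoeff b α = 1) (x : g) :
    ∃ r ∈ reductivePart b α, ∃ n ∈ nilpotentPart b α, ∃ u ∈ vertexEigenspace b α 1,
      x = r + n + u := by
  have htop : parabolic b α ⊔ vertexEigenspace b α 1 = ⊤ := by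
    rw [eq_top_iff, ← cartan_sup_iSup_rootSpace H]
    refine sup_le (le_sup_of_le_left cartan_le_parabolic) (iSup_le fun β => ?_)
    by_cases h : rootCoeff b α β ≤ 0
    · exact le_sup_of_le_left (rootSpace_le_parabolic h)
    · have h1 := rootCoeff_le_highestCoeff b α β
      have h2 : rootCoeff b α β = 1 := by omega
      have := rootSpace_le_vertexEigenspace hk β
      rw [h2, Int.cast_one] at this
      exact le_sup_of_le_right this
  have hx : x ∈ parabolic b α ⊔ vertexEigenspace b α 1 := by rw [htop]; trivial
  obtain ⟨p, hp, u, hu, rfl⟩ := Submodule.mem_sup.mp hx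
  rw [parabolic_eq] at hp
  obtain ⟨r, hr, n, hn, rfl⟩ := Submodule.mem_sup.mp hp
  exact ⟨r, hr, n, hn, u, hu, rfl⟩

theorem killingForm_parabolic_nilpotentPart (hk : highestCoeff b α = 1) {x y : g}
    (hx : x ∈ parabolic b α) (hy : y ∈ nilpotentPart b α) : killingForm ℂ g x y = 0 := by
  rw [parabolic_eq] at hx
  obtain ⟨r, hr, n, hn, rfl⟩ := Submodule.mem_sup.mp hx
  have hr := reductivePart_le_vertexEigenspace hk hr
  have hn := nilpotentPart_le_vertexEigenspace hk hn
  have hy := nilpotentPart_le_vertexEigenspace hk hy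
  rw [map_add, LinearMap.add_apply, killingForm_vertexEigenspace (by norm_num) hr hy,
    killingForm_vertexEigenspace (by norm_num) hn hy, add_zero]

theorem eq_zero_of_killingForm_eq_zero {x : g} (h : ∀ y, killingForm ℂ g x y = 0) : x = 0 :=
  (LieAlgebra.IsKilling.killingForm_nondegenerate ℂ g).1 x h

/-- The component of `x` in the nilpotent radical is orthogonal to the parabolic. The remaining
part, in degrees 0 and 1, is then orthogonal to the parabolic by hypothesis and to degree 1 by
degree, so it vanishes. -/
theorem mem_nilpotentPart_of_orthogonal (hk : highestCoeff b α = 1) {x : g}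
    (h : ∀ p ∈ parabolic b α, killingForm ℂ g x p = 0) : x ∈ nilpotentPart b α := by
  obtain ⟨r, hr, n, hn, u, hu, rfl⟩ := exists_eq_add_of_highestCoeff_eq_one hk x
  suffices h0 : r + u = 0 by
    rwa [add_right_comm, h0, zero_add]
  refine eq_zero_of_killingForm_eq_zero fun y => ?_
  obtain ⟨r', hr', n', hn', u', hu', rfl⟩ := exists_eq_add_of_highestCoeff_eq_one hk y
  have hp : r' + n' ∈ parabolic b α :=
    add_mem (reductivePart_le_parabolic hr') (nilpotentPart_le_parabolic hn')
  have h1 := h _ hp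
  rw [add_right_comm, map_add _ (r + u) n, LinearMap.add_apply, killingForm_comm n,
    killingForm_parabolic_nilpotentPart hk hp hn, add_zero] at h1
  rw [map_add _ (r' + n') u', h1, map_add, LinearMap.add_apply,
    killingForm_vertexEigenspace (by norm_num) (reductivePart_le_vertexEigenspace hk hr) hu',
    killingForm_vertexEigenspace (by norm_num) hu hu']
  simp

/-- The degree 1 component pairs only with degree -1, which is the nilpotent radical, and is
therefore zero by nondegeneracy. -/
theorem mem_parabolic_of_orthogonal (hk : highestCoeff b α = 1) {x : g}
    (h : ∀ n ∈ nilpotentPart b α, killingForm ℂ g x n = 0) : x ∈ parabolic b α := by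
  obtain ⟨r, hr, n, hn, u, hu, rfl⟩ := exists_eq_add_of_highestCoeff_eq_one hk x
  have hp : r + n ∈ parabolic b α :=
    add_mem (reductivePart_le_parabolic hr) (nilpotentPart_le_parabolic hn)
  suffices h0 : u = 0 by rwa [h0, add_zero]
  refine eq_zero_of_killingForm_eq_zero fun y => ?_
  obtain ⟨r', hr', n', hn', u', hu', rfl⟩ := exists_eq_add_of_highestCoeff_eq_one hk y
  have h1 := h _ hn'
  rw [map_add _ (r + n) u, LinearMap.add_apply, killingForm_parabolic_nilpotentPart hk hp hn',
    zero_add] at h1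
  rw [map_add, map_add, h1,
    killingForm_vertexEigenspace (by norm_num) hu (reductivePart_le_vertexEigenspace hk hr'),
    killingForm_vertexEigenspace (by norm_num) hu hu']
  simp

theorem exists_eq_add_of_mem_parabolic {x : g} (hx : x ∈ parabolic b α) :
    ∃ r ∈ reductivePart b α, ∃ n ∈ nilpotentPart b α, r + n = x := by
  rw [parabolic_eq] at hx
  exact Submodule.mem_sup.mp hx

/-- The bracket has components in degrees 0, -1, -2 only, all orthogonal to the radical in degree
-1; no addition of roots is needed. -/
theorem lie_mem_parabolic (hk : highestCoeff b α = 1) {x y : g}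
    (hx : x ∈ parabolic b α) (hy : y ∈ parabolic b α) : ⁅x, y⁆ ∈ parabolic b α := by
  refine mem_parabolic_of_orthogonal hk fun m hm => ?_
  obtain ⟨r, hr, n, hn, rfl⟩ := exists_eq_add_of_mem_parabolic hx
  obtain ⟨r', hr', n', hn', rfl⟩ := exists_eq_add_of_mem_parabolic hy
  replace hr := reductivePart_le_vertexEigenspace hk hr
  replace hr' := reductivePart_le_vertexEigenspace hk hr'
  replace hn := nilpotentPart_le_vertexEigenspace hk hn
  replace hn' := nilpotentPart_le_vertexEigenspace hk hn'
  replace hm := nilpotentPart_le_vertexEigenspace hk hm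
  simp only [add_lie, lie_add, map_add, LinearMap.add_apply]
  rw [killingForm_vertexEigenspace (by norm_num) (lie_mem_vertexEigenspace hr hr') hm,
    killingForm_vertexEigenspace (by norm_num) (lie_mem_vertexEigenspace hr hn') hm,
    killingForm_vertexEigenspace (by norm_num) (lie_mem_vertexEigenspace hn hr') hm,
    killingForm_vertexEigenspace (by norm_num) (lie_mem_vertexEigenspace hn hn') hm]
  simp

theorem lie_mem_nilpotentPart (hk : highestCoeff b α = 1) {x y : g}
    (hx : x ∈ parabolic b α) (hy : y ∈ nilpotentPart b α) : ⁅x, y⁆ ∈ nilpotentPart b α := by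
  refine mem_nilpotentPart_of_orthogonal hk fun p hp => ?_
  rw [killingForm, LieModule.traceForm_apply_lie_apply', neg_eq_zero, LieModule.traceForm_comm]
  exact killingForm_parabolic_nilpotentPart hk (lie_mem_parabolic hk hx hp) hy

/-- The bracket has degree -2, which could pair only with degree 2, and the grading stops at 1. -/
theorem lie_eq_zero_of_mem_nilpotentPart (hk : highestCoeff b α = 1) {x y : g}
    (hx : x ∈ nilpotentPart b α) (hy : y ∈ nilpotentPart b α) : ⁅x, y⁆ = 0 := by
  refine eq_zero_of_killingForm_eq_zero fun z => ?_
  replace hx := nilpotentPart_le_vertexEigenspace hk hx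
  replace hy := nilpotentPart_le_vertexEigenspace hk hy
  have hxy := lie_mem_vertexEigenspace hx hy
  obtain ⟨r, hr, n, hn, u, hu, rfl⟩ := exists_eq_add_of_highestCoeff_eq_one hk z
  rw [map_add, map_add,
    killingForm_vertexEigenspace (by norm_num) hxy (reductivePart_le_vertexEigenspace hk hr),
    killingForm_vertexEigenspace (by norm_num) hxy (nilpotentPart_le_vertexEigenspace hk hn),
    killingForm_vertexEigenspace (by norm_num) hxy hu]
  simp

/-- Equal reductive parts mean congruence modulo the radical. In this form `Δ_α` consists of the
pairs (x + y, x) obtained by evaluating (x + uy, x) at u = 1. -/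
theorem mem_deltaSet_iff {p : g × g} :
    p ∈ deltaSet b α ↔ p.1 ∈ parabolic b α ∧ p.1 - p.2 ∈ nilpotentPart b α := by
  constructor
  · rintro ⟨h1, -, l, -, h3, h4⟩
    refine ⟨h1, ?_⟩
    simpa using sub_mem h3 h4
  · rintro ⟨h1, h2⟩
    obtain ⟨r, hr, n, hn, h⟩ := exists_eq_add_of_mem_parabolic h1
    refine ⟨h1, ?_, r, hr, ?_, ?_⟩
    · simpa using sub_mem h1 (nilpotentPart_le_parabolic h2)
    · rw [← h]
      simpa using hn
    · have : p.2 - r = n - (p.1 - p.2) := by rw [← h]; abel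
      rw [this]
      exact sub_mem hn h2

end Parabolic

/-! ### Lagrangian reduction. -/

/-- Reduction of Lagrangian subalgebras along a coisotropic subalgebra `S` with quotient `G`: the
Lagrangian subalgebras of `L` inside `S` and transversal to `P` correspond to the Lagrangian
subalgebras of `G` transversal to the image `D` of `S ∩ P`. -/
theorem bijOn_lagrangian_reduction {E L G : Type*} [LieRing E] [LieAlgebra ℂ E] [LieRing L]
    [LieAlgebra ℂ L] [LieRing G] [LieAlgebra ℂ G] {i : E →ₗ⁅ℂ⁆ L} {e : E →ₗ⁅ℂ⁆ G}
    {S : LieSubalgebra ℂ E} {B : LinearMap.BilinForm ℂ L} {C : LinearMap.BilinForm ℂ G}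
    {P : Submodule ℂ L} {D : Submodule ℂ G} (hi : Function.Injective i)
    (hform : ∀ m ∈ S, ∀ m' ∈ S, B (i m) (i m') = C (e m) (e m'))
    (hdual : ∀ q, (∀ m ∈ S, e m = 0 → B (i m) q = 0) → ∃ m ∈ S, i m = q)
    (hsurj : ∀ y, ∃ m ∈ S, e m = y)
    (hsum : ∀ q, ∃ m ∈ S, ∃ p ∈ P, i m + p = q)
    (hD : ∀ y ∈ D, ∃ m ∈ S, i m ∈ P ∧ e m = y)
    (hP : ∀ m ∈ S, i m ∈ P → e m ∈ D)
    (hker : ∀ m ∈ S, i m ∈ P → e m = 0 → m = 0) :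
    Set.BijOn (fun W : LieSubalgebra ℂ L => (W.comap i).map e)
      {W | IsLagrangian B W ∧ IsCompl W.toSubmodule P ∧
        W.toSubmodule ≤ S.toSubmodule.map (i : E →ₗ[ℂ] L)}
      {W | IsLagrangian C W ∧ IsCompl W.toSubmodule D} := by
  have hmem : ∀ (W : LieSubalgebra ℂ L) y, y ∈ (W.comap i).map e ↔ ∃ m, i m ∈ W ∧ e m = y :=
    fun W y => by simp [LieSubalgebra.mem_map]
  have hS : ∀ W : LieSubalgebra ℂ L, W.toSubmodule ≤ S.toSubmodule.map (i : E →ₗ[ℂ] L) →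
      ∀ m, i m ∈ W → m ∈ S := by
    intro W hW m hm
    obtain ⟨m', hm', h⟩ := hW hm
    rwa [← hi h]
  -- The kernel of `e` on `S` is orthogonal to `S`, hence to `W`, so it lies in `W` by maximality of
  -- a Lagrangian. Therefore `W` is saturated for `e` (`hlift`), which yields injectivity.
  have hkerW : ∀ W : LieSubalgebra ℂ L, IsLagrangian B W →
      W.toSubmodule ≤ S.toSubmodule.map (i : E →ₗ[ℂ] L) → ∀ m ∈ S, e m = 0 → i m ∈ W := by
    intro W hL hW m hm h0
    rw [← LieSubalgebra.mem_toSubmodule, ← hL]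
    intro w hw
    obtain ⟨m', hm', rfl⟩ := hW hw
    change B (i m') (i m) = 0
    rw [hform m' hm' m hm, h0, map_zero]
  have hlift : ∀ W : LieSubalgebra ℂ L, IsLagrangian B W →
      W.toSubmodule ≤ S.toSubmodule.map (i : E →ₗ[ℂ] L) → ∀ m ∈ S,
        e m ∈ (W.comap i).map e → i m ∈ W := by
    intro W hL hW m hm h
    obtain ⟨m', hm', hmm⟩ := (hmem W _).mp h
    have := hkerW W hL hW (m - m') (sub_mem hm (hS W hW m' hm'))
      (by rw [map_sub, hmm, sub_self])
    rw [map_sub] at this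
    simpa using add_mem this hm'
  refine ⟨?_, ?_, ?_⟩
  · rintro W ⟨hL, hc, hW⟩
    refine ⟨?_, ?_⟩
    · ext y
      rw [LieSubalgebra.mem_toSubmodule]
      constructor
      · intro hy
        obtain ⟨m, hm, rfl⟩ := hsurj y
        refine (hmem W _).mpr ⟨m, ?_, rfl⟩
        rw [← LieSubalgebra.mem_toSubmodule, ← hL]
        intro w hw
        obtain ⟨m', hm', rfl⟩ := hW hw
        change B (i m') (i m) = 0
        rw [hform m' hm' m hm]
        exact hy _ ((hmem W _).mpr ⟨m', hw, rfl⟩)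
      · intro hy y' hy'
        obtain ⟨m, hm, rfl⟩ := (hmem W _).mp hy
        obtain ⟨m', hm', rfl⟩ := (hmem W _).mp hy'
        change C (e m') (e m) = 0
        rw [← hform m' (hS W hW m' hm') m (hS W hW m hm)]
        have : i m ∈ B.orthogonal W.toSubmodule := by rw [hL]; exact hm
        exact this _ hm'
    · refine ⟨Submodule.disjoint_def.mpr ?_, Submodule.codisjoint_iff_exists_add_eq.mpr ?_⟩
      · intro y hy hyD
        obtain ⟨m, hm, hmP, rfl⟩ := hD y hyD
        have h0 : i m = 0 := Submodule.disjoint_def.mp hc.disjoint _ (hlift W hL hW m hm hy) hmP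
        rw [hi (h0.trans (map_zero i).symm), map_zero]
      · intro y
        obtain ⟨m, hm, rfl⟩ := hsurj y
        obtain ⟨w, p, hw, hp, h⟩ := Submodule.codisjoint_iff_exists_add_eq.mp hc.codisjoint (i m)
        obtain ⟨m', hm', rfl⟩ := hW hw
        have hp' : p = i (m - m') := by
          rw [map_sub, ← h]
          exact (add_sub_cancel_left _ _).symm
        subst hp'
        refine ⟨e m', e (m - m'), (hmem W _).mpr ⟨m', hw, rfl⟩, hP _ (sub_mem hm hm') hp, ?_⟩
        rw [map_sub, add_sub_cancel]
  · rintro W ⟨hL, -, hW⟩ W' ⟨hL', -, hW'⟩ h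
    have h : (W.comap i).map e = (W'.comap i).map e := h
    ext w
    constructor
    · intro hw
      obtain ⟨m, hm, rfl⟩ := hW hw
      exact hlift W' hL' hW' m hm (h ▸ (hmem W _).mpr ⟨m, hw, rfl⟩)
    · intro hw
      obtain ⟨m, hm, rfl⟩ := hW' hw
      exact hlift W hL hW m hm (h ▸ (hmem W' _).mpr ⟨m, hw, rfl⟩)
  · rintro V ⟨hL, hc⟩
    have hV : ∀ m, i m ∈ (V.comap e ⊓ S).map i ↔ e m ∈ V ∧ m ∈ S := by
      intro m
      rw [LieSubalgebra.mem_map]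
      constructor
      · rintro ⟨m', hm', h⟩
        rw [← hi h]
        exact hm'
      · intro h
        exact ⟨m, h, rfl⟩
    -- The inverse of the correspondence is the full preimage of `V` in `S`; it contains the kernel
    -- of `e` on `S`, so `hdual` forces its orthogonal complement into `S`.
    refine ⟨(V.comap e ⊓ S).map i, ⟨?_, ⟨?_, ?_⟩, ?_⟩, ?_⟩
    · ext q
      rw [LieSubalgebra.mem_toSubmodule]
      constructor
      · intro hq
        obtain ⟨m, hm, rfl⟩ := hdual q fun m hm h0 =>
          hq _ ((hV m).mpr ⟨by rw [h0]; exact zero_mem V, hm⟩)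
        refine (hV m).mpr ⟨?_, hm⟩
        rw [← LieSubalgebra.mem_toSubmodule, ← hL]
        intro y hy
        obtain ⟨m', hm', rfl⟩ := hsurj y
        change C (e m') (e m) = 0
        rw [← hform m' hm' m hm]
        exact hq _ ((hV m').mpr ⟨hy, hm'⟩)
      · intro hq q' hq'
        obtain ⟨m, ⟨hm, hmS⟩, rfl⟩ := (LieSubalgebra.mem_map _ _ _).mp hq
        obtain ⟨m', ⟨hm', hmS'⟩, rfl⟩ := (LieSubalgebra.mem_map _ _ _).mp hq'
        change B (i m') (i m) = 0
        rw [hform m' hmS' m hmS]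
        have : e m ∈ C.orthogonal V.toSubmodule := by rw [hL]; exact hm
        exact this _ hm'
    · refine Submodule.disjoint_def.mpr fun q hq hqP => ?_
      obtain ⟨m, ⟨hm, hmS⟩, rfl⟩ := (LieSubalgebra.mem_map _ _ _).mp hq
      have h0 : e m = 0 := Submodule.disjoint_def.mp hc.disjoint _ hm (hP m hmS hqP)
      have h1 := hker m hmS hqP h0
      subst h1
      exact map_zero i
    · refine Submodule.codisjoint_iff_exists_add_eq.mpr fun q => ?_
      obtain ⟨m, hm, p, hp, rfl⟩ := hsum q
      obtain ⟨y, d, hy, hd, h⟩ := Submodule.codisjoint_iff_exists_add_eq.mp hc.codisjoint (e m)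
      obtain ⟨m', hm', hmP, rfl⟩ := hD d hd
      -- The `D`-component of `e m` lifts to an element of `S ∩ P`, which is moved from the first
      -- summand to the second.
      refine ⟨i (m - m'), i m' + p, (hV _).mpr ⟨?_, sub_mem hm hm'⟩, add_mem hmP hp, ?_⟩
      · rw [map_sub, ← h, add_sub_cancel_right]
        exact hy
      · rw [map_sub]
        abel
    · intro q hq
      obtain ⟨m, ⟨-, hmS⟩, rfl⟩ := (LieSubalgebra.mem_map _ _ _).mp hq
      exact ⟨m, hmS, rfl⟩
    · ext y
      refine (hmem _ y).trans ?_
      constructor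
      · rintro ⟨m, hm, rfl⟩
        exact ((hV m).mp hm).1
      · intro hy
        obtain ⟨m, hm, rfl⟩ := hsurj y
        exact ⟨m, (hV m).mpr ⟨hy, hm⟩, rfl⟩

/-! ### Evaluation maps and the copy of `g[[u]]`. -/

section LoopMaps

variable {g : Type*} [LieRing g] [LieAlgebra ℂ g]

theorem inclLoop_apply (m : (ℂ[T;T⁻¹] ⊗[ℂ] g) × g) :
    inclLoop g m = (LinearMap.rTensor g (laurentEval laurentVar).toLinearMap m.1, m.2) := rfl

theorem evalOne_fst (m : (ℂ[T;T⁻¹] ⊗[ℂ] g) × g) :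
    (evalOne g m).1 = TensorProduct.lid ℂ g
      (LinearMap.rTensor g (laurentEval (1 : ℂˣ)).toLinearMap m.1) := rfl

theorem evalOne_snd (m : (ℂ[T;T⁻¹] ⊗[ℂ] g) × g) : (evalOne g m).2 = m.2 := rfl

theorem lid_evalOne_T_tmul (n : ℤ) (x : g) :
    TensorProduct.lid ℂ g (LinearMap.rTensor g (laurentEval (1 : ℂˣ)).toLinearMap
      (LaurentPolynomial.T n ⊗ₜ x)) = x := by
  rw [LinearMap.rTensor_tmul, AlgHom.toLinearMap_apply, laurentEval_T]
  simp

theorem rTensor_laurentVar_T_tmul (n : ℤ) (x : g) :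
    LinearMap.rTensor g (laurentEval laurentVar).toLinearMap (LaurentPolynomial.T n ⊗ₜ x) =
      HahnSeries.single n (1 : ℂ) ⊗ₜ x := by
  rw [LinearMap.rTensor_tmul, AlgHom.toLinearMap_apply, laurentEval_laurentVar_T]

theorem rTensor_laurentVar_injective :
    Function.Injective (LinearMap.rTensor g (laurentEval laurentVar).toLinearMap) := by
  rw [injective_iff_map_eq_zero]
  intro z hz
  obtain ⟨s, hs⟩ := exists_eq_sum_T_tmul z
  rw [hs s subset_rfl]
  simp [hz]

theorem inclLoop_injective : Function.Injective (inclLoop g) := by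
  intro m m' h
  rw [inclLoop_apply, inclLoop_apply, Prod.mk.injEq] at h
  exact Prod.ext (rTensor_laurentVar_injective h.1) h.2

theorem loopCoeff_ofPowerSeries (n : ℤ) (p : ℂ⟦X⟧ ⊗[ℂ] g) :
    loopCoeff g n (LinearMap.rTensor g (HahnSeries.ofPowerSeriesAlg ℤ ℂ).toLinearMap p) =
      if n < 0 then 0 else TensorProduct.lid ℂ g
        (LinearMap.rTensor g (PowerSeries.coeff n.natAbs) p) := by
  induction p using TensorProduct.induction_on with
  | zero => simp
  | add p q hp hq =>
    rw [map_add, map_add, hp, hq]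
    split_ifs <;> simp
  | tmul f x =>
    simp only [LinearMap.rTensor_tmul, loopCoeff_tmul, AlgHom.toLinearMap_apply,
      TensorProduct.lid_tmul]
    change (HahnSeries.ofPowerSeries ℤ ℂ f).coeff n • x = _
    rw [PowerSeries.coeff_coe]
    split_ifs <;> simp

theorem mem_powerSeriesPart_coeff {q : (LaurentSeries ℂ ⊗[ℂ] g) × g}
    (hq : q ∈ powerSeriesPart g) :
    (∀ n < 0, loopCoeff g n q.1 = 0) ∧ q.2 = loopCoeff g 0 q.1 := by
  obtain ⟨p, rfl⟩ := hq
  refine ⟨fun n hn => ?_, ?_⟩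
  · exact (loopCoeff_ofPowerSeries n p).trans (if_pos hn)
  · exact ((loopCoeff_ofPowerSeries 0 p).trans (if_neg (by omega))).symm

theorem powerSeries_mem_powerSeriesPart (p : ℂ⟦X⟧ ⊗[ℂ] g) :
    (LinearMap.rTensor g (HahnSeries.ofPowerSeriesAlg ℤ ℂ).toLinearMap p,
      TensorProduct.lid ℂ g (LinearMap.rTensor g (PowerSeries.coeff 0) p)) ∈ powerSeriesPart g :=
  ⟨p, rfl⟩

theorem linear_mem_powerSeriesPart (x y : g) :
    (HahnSeries.single 0 (1 : ℂ) ⊗ₜ x + HahnSeries.single 1 (1 : ℂ) ⊗ₜ y, x) ∈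
      powerSeriesPart g := by
  refine ⟨1 ⊗ₜ x + PowerSeries.X ⊗ₜ y, ?_⟩
  have hX : HahnSeries.ofPowerSeriesAlg ℤ ℂ (PowerSeries.X : ℂ⟦X⟧) = HahnSeries.single 1 1 :=
    HahnSeries.ofPowerSeries_X
  have h1 : HahnSeries.single (0 : ℤ) (1 : ℂ) = 1 := rfl
  simp [hX, h1]

end LoopMaps

/-! ### The filtration that describes the order when k = 1. -/

section Filtration

variable {g : Type*} [LieRing g] [LieAlgebra ℂ g] [FiniteDimensional ℂ g] [IsSimple ℂ g]
  {H : LieSubalgebra ℂ g} [H.IsCartanSubalgebra]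
  {b : (rootSystem H).Base} {α : b.support}

variable (b α) in
/-- The filtration `g ⊇ P ⊇ N ⊇ 0` by the parabolic subalgebra `P_α⁻` and its nilpotent radical,
indexed so that `P` is in degree `0` and `N` in degree `1`. -/
def parabolicFiltration (n : ℤ) : Submodule ℂ g :=
  if n < 0 then ⊤ else if n = 0 then parabolic b α else if n = 1 then nilpotentPart b α else ⊥

theorem parabolicFiltration_neg {n : ℤ} (hn : n < 0) : parabolicFiltration b α n = ⊤ := if_pos hn

theorem parabolicFiltration_zero : parabolicFiltration b α 0 = parabolic b α := by
  simp [parabolicFiltration]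

theorem parabolicFiltration_one : parabolicFiltration b α 1 = nilpotentPart b α := by
  simp [parabolicFiltration]

theorem parabolicFiltration_of_two_le {n : ℤ} (hn : 2 ≤ n) : parabolicFiltration b α n = ⊥ := by
  rw [parabolicFiltration, if_neg (by omega), if_neg (by omega), if_neg (by omega)]

theorem parabolicFiltration_antitone : Antitone (parabolicFiltration b α) := by
  refine antitone_int_of_succ_le fun n => ?_
  rcases lt_trichotomy n 0 with hn | rfl | hn
  · rw [parabolicFiltration_neg hn]
    exact le_top
  · rw [zero_add, parabolicFiltration_one, parabolicFiltration_zero]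
    exact nilpotentPart_le_parabolic
  · rw [parabolicFiltration_of_two_le (by omega)]
    exact bot_le

theorem killingForm_parabolicFiltration (hk : highestCoeff b α = 1) {n m : ℤ} (h : 0 < n + m)
    {x y : g} (hx : x ∈ parabolicFiltration b α n) (hy : y ∈ parabolicFiltration b α m) :
    killingForm ℂ g x y = 0 := by
  wlog hle : n ≤ m generalizing n m x y
  · rw [killingForm_comm]
    exact this (by omega) hy hx (by omega)
  rcases le_or_gt 2 m with hm | hm
  · rw [parabolicFiltration_of_two_le hm, Submodule.mem_bot] at hy
    rw [hy, map_zero]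
  · obtain rfl : m = 1 := by omega
    rw [parabolicFiltration_one] at hy
    refine killingForm_parabolic_nilpotentPart hk ?_ hy
    rw [← parabolicFiltration_zero]
    exact parabolicFiltration_antitone (by omega) hx

/-- Together with `killingForm_parabolicFiltration`, this makes degrees n and 1 - n exact orthogonal
complements. The same shift appears in `formQ_geom_sub_single`. -/
theorem mem_parabolicFiltration_of_orthogonal (hk : highestCoeff b α = 1) {n : ℤ} {x : g}
    (h : ∀ y ∈ parabolicFiltration b α (1 - n), killingForm ℂ g x y = 0) :
    x ∈ parabolicFiltration b α n := by
  rcases lt_or_ge n 0 with hn | hn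
  · rw [parabolicFiltration_neg hn]
    trivial
  rcases le_or_gt 2 n with hn' | hn'
  · rw [parabolicFiltration_neg (by omega)] at h
    rw [eq_zero_of_killingForm_eq_zero fun y => h y trivial]
    exact zero_mem _
  obtain rfl | rfl : n = 0 ∨ n = 1 := by omega
  · rw [sub_zero, parabolicFiltration_one] at h
    rw [parabolicFiltration_zero]
    exact mem_parabolic_of_orthogonal hk h
  · rw [sub_self, parabolicFiltration_zero] at h
    rw [parabolicFiltration_one]
    exact mem_nilpotentPart_of_orthogonal hk h

theorem lie_mem_parabolicFiltration (hk : highestCoeff b α = 1) {n m : ℤ} {x y : g}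
    (hx : x ∈ parabolicFiltration b α n) (hy : y ∈ parabolicFiltration b α m) :
    ⁅x, y⁆ ∈ parabolicFiltration b α (n + m) := by
  wlog hle : n ≤ m generalizing n m x y
  · rw [← lie_skew, add_comm]
    exact neg_mem (this hy hx (by omega))
  rcases lt_or_ge (n + m) 0 with h | h
  · rw [parabolicFiltration_neg h]
    trivial
  rcases le_or_gt 2 m with hm | hm
  · rw [parabolicFiltration_of_two_le hm, Submodule.mem_bot] at hy
    rw [hy, lie_zero]
    exact zero_mem _
  obtain rfl | rfl : m = 0 ∨ m = 1 := by omega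
  · obtain rfl : n = 0 := by omega
    rw [parabolicFiltration_zero] at *
    exact lie_mem_parabolic hk hx hy
  · rw [parabolicFiltration_one] at hy
    obtain rfl | rfl | rfl : n = -1 ∨ n = 0 ∨ n = 1 := by omega
    · rw [neg_add_cancel, parabolicFiltration_zero]
      -- For y, z in the radical, K([x, y], z) = K(x, [y, z]) = 0 because the radical is abelian.
      refine mem_parabolic_of_orthogonal hk fun z hz => ?_
      rw [killingForm, LieModule.traceForm_apply_lie_apply,
        lie_eq_zero_of_mem_nilpotentPart hk hy hz, map_zero]
    · rw [parabolicFiltration_zero] at hx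
      rw [zero_add, parabolicFiltration_one]
      exact lie_mem_nilpotentPart hk hx hy
    · rw [parabolicFiltration_one] at hx
      rw [lie_eq_zero_of_mem_nilpotentPart hk hx hy]
      exact zero_mem _

/-- Degree n in u is degree -n in u⁻¹, so a root is admitted when its coefficient of α, one of -1,
0, 1, is at most -n: all roots for n < 0, those of the parabolic for n = 0, those of the radical for
n = 1, none beyond. The Cartan subalgebra enters for n ≤ 0. -/
theorem mem_comap_maxOrder_iff (hk : highestCoeff b α = 1) (z : ℂ[T;T⁻¹] ⊗[ℂ] g) :
    LinearMap.rTensor g (laurentEval laurentVar⁻¹).toLinearMap z ∈ maxOrder (vertex b α) ↔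
      ∀ n, loopCoeff g n (LinearMap.rTensor g (laurentEval laurentVar).toLinearMap z) ∈
        parabolicFiltration b α n := by
  constructor
  · intro hz n
    refine loopCoeff_mem_of_mem_comap_maxOrder b α (by omega) (fun hn => ?_) (fun β hβ => ?_) hz
    · refine le_trans ?_ (parabolicFiltration_antitone hn)
      rw [parabolicFiltration_zero]
      exact cartan_le_parabolic
    · rw [hk, mul_one] at hβ
      have h1 := neg_highestCoeff_le_rootCoeff b α β
      rcases le_or_gt n 0 with hn | hn
      · rcases hn.lt_or_eq with hn | rfl
        · rw [parabolicFiltration_neg hn]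
          exact le_top
        · rw [parabolicFiltration_zero]
          exact rootSpace_le_parabolic (by omega)
      · obtain rfl : n = 1 := by omega
        rw [parabolicFiltration_one]
        exact rootSpace_le_nilpotentPart (by omega)
  · intro h
    have key : ∀ n, parabolicFiltration b α n ≤ (maxOrder (vertex b α)).comap
        (TensorProduct.mk ℂ (LaurentSeries ℂ) g (HahnSeries.single (-n) 1)) := by
      intro n
      have hroot : ∀ β : H.root, rootCoeff b α β ≤ -n → (rootSpace H β.1).toSubmodule ≤
          (maxOrder (vertex b α)).comap
            (TensorProduct.mk ℂ (LaurentSeries ℂ) g (HahnSeries.single (-n) 1)) := by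
        intro β hβ x hx
        refine single_tmul_mem_maxOrder_of_mem_rootSpace ?_ hx
        rw [re_root_apply_vertex, hk, Int.cast_one, div_one]
        exact_mod_cast hβ
      have hcartan : n ≤ 0 → H.toSubmodule ≤ (maxOrder (vertex b α)).comap
            (TensorProduct.mk ℂ (LaurentSeries ℂ) g (HahnSeries.single (-n) 1)) :=
        fun hn x hx => single_tmul_mem_maxOrder_of_mem_cartan (by omega) hx
      rcases lt_or_ge n 0 with hn | hn
      · rw [parabolicFiltration_neg hn, ← cartan_sup_iSup_rootSpace H]
        refine sup_le (hcartan hn.le) (iSup_le fun β => hroot β ?_)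
        have := rootCoeff_le_highestCoeff b α β
        omega
      rcases le_or_gt 2 n with hn' | hn'
      · rw [parabolicFiltration_of_two_le hn']
        exact bot_le
      obtain rfl | rfl : n = 0 ∨ n = 1 := by omega
      · rw [parabolicFiltration_zero]
        refine sup_le (hcartan le_rfl) (iSup_le fun β => hroot β.1 ?_)
        rcases β.2 with h | h
        · simpa using rootCoeff_nonpos_of_not_isPos b α h
        · simp [h.2]
      · rw [parabolicFiltration_one]
        refine iSup_le fun β => hroot β.1 ?_
        have := rootCoeff_nonpos_of_not_isPos b α β.2.1
        have := β.2.2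
        omega
    obtain ⟨s, hs⟩ := exists_eq_sum_T_tmul z
    rw [hs s subset_rfl, map_sum]
    refine sum_mem fun n _ => ?_
    rw [LinearMap.rTensor_tmul, AlgHom.toLinearMap_apply, laurentEval_laurentVar_inv_T]
    exact key n (h n)

end Filtration

/-! ### The coisotropic subalgebra and the bijection for k = 1. -/

section OrderSubalgebra

variable {g : Type*} [LieRing g] [LieAlgebra ℂ g] [FiniteDimensional ℂ g] [IsSimple ℂ g]
  {H : LieSubalgebra ℂ g} [H.IsCartanSubalgebra]
  {b : (rootSystem H).Base} {α : b.support}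

theorem lie_mem_comap_maxOrder (hk : highestCoeff b α = 1) {y z : ℂ[T;T⁻¹] ⊗[ℂ] g}
    (hy : LinearMap.rTensor g (laurentEval laurentVar⁻¹).toLinearMap y ∈ maxOrder (vertex b α))
    (hz : LinearMap.rTensor g (laurentEval laurentVar⁻¹).toLinearMap z ∈ maxOrder (vertex b α)) :
    LinearMap.rTensor g (laurentEval laurentVar⁻¹).toLinearMap ⁅y, z⁆ ∈
      maxOrder (vertex b α) := by
  have hT : ∀ (n : ℤ), ∀ x ∈ parabolicFiltration b α n,
      LinearMap.rTensor g (laurentEval laurentVar⁻¹).toLinearMap (LaurentPolynomial.T n ⊗ₜ x) ∈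
        maxOrder (vertex b α) := by
    intro n x hx
    rw [mem_comap_maxOrder_iff hk]
    intro m
    rw [rTensor_laurentVar_T_tmul, loopCoeff_single_tmul]
    split_ifs with h
    · rwa [h]
    · exact zero_mem _
  rw [mem_comap_maxOrder_iff hk] at hy hz
  obtain ⟨s, hs⟩ := exists_eq_sum_T_tmul y
  obtain ⟨s', hs'⟩ := exists_eq_sum_T_tmul z
  have hsum := sum_lie_sum s s'
    (fun n => (LaurentPolynomial.T n : ℂ[T;T⁻¹]) ⊗ₜ[ℂ] loopCoeff g n
      (LinearMap.rTensor g (laurentEval laurentVar).toLinearMap y))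
    (fun n => (LaurentPolynomial.T n : ℂ[T;T⁻¹]) ⊗ₜ[ℂ] loopCoeff g n
      (LinearMap.rTensor g (laurentEval laurentVar).toLinearMap z))
  rw [← hs s subset_rfl, ← hs' s' subset_rfl] at hsum
  refine Eq.subst (motive := fun v => LinearMap.rTensor g (laurentEval laurentVar⁻¹).toLinearMap v ∈
    maxOrder (vertex b α)) hsum.symm ?_
  rw [map_sum]
  refine sum_mem fun n _ => ?_
  rw [map_sum]
  refine sum_mem fun m _ => ?_
  rw [LieAlgebra.ExtendScalars.bracket_tmul, ← LaurentPolynomial.T_add]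
  exact hT _ _ (lie_mem_parabolicFiltration hk (hy _) (hz _))

variable (b) in
/-- The subalgebra `(𝕆_α ∩ g[u, u⁻¹]) ⊕ g` of `g[u, u⁻¹] ⊕ g`, for a simple root `α` with
coefficient `1` in the highest root. -/
def orderSubalgebra (hk : highestCoeff b α = 1) : LieSubalgebra ℂ ((ℂ[T;T⁻¹] ⊗[ℂ] g) × g) :=
  { ((maxOrder (vertex b α)).comap
      (LinearMap.rTensor g (laurentEval laurentVar⁻¹).toLinearMap)).prod ⊤ with
    lie_mem' := fun hy hz => ⟨lie_mem_comap_maxOrder hk hy.1 hz.1, trivial⟩ }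

theorem mem_orderSubalgebra (hk : highestCoeff b α = 1) {m : (ℂ[T;T⁻¹] ⊗[ℂ] g) × g} :
    m ∈ orderSubalgebra b hk ↔ ∀ n, loopCoeff g n
      (LinearMap.rTensor g (laurentEval laurentVar).toLinearMap m.1) ∈
        parabolicFiltration b α n := by
  rw [← mem_comap_maxOrder_iff hk]
  exact and_iff_left trivial

theorem map_orderSubalgebra (hk : highestCoeff b α = 1) :
    (orderSubalgebra b hk).toSubmodule.map (inclLoop g : _ →ₗ[ℂ] (LaurentSeries ℂ ⊗[ℂ] g) × g) =
      (orderLaurent b α).prod ⊤ := by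
  ext q
  constructor
  · rintro ⟨m, hm, rfl⟩
    exact ⟨⟨m.1, hm.1, rfl⟩, trivial⟩
  · rintro ⟨⟨z, hz, h⟩, -⟩
    exact ⟨(z, q.2), ⟨hz, trivial⟩, Prod.ext h rfl⟩

/-- In positive total degree a(u) contributes nothing, and the filtration makes K(x, y) vanish as
well. So the form behaves as if u = 1. -/
theorem formQ_geom_single_parabolicFiltration (hk : highestCoeff b α = 1) {n m : ℤ} {x y : g}
    (hx : x ∈ parabolicFiltration b α n) (hy : y ∈ parabolicFiltration b α m) :
    formQ g (1 - PowerSeries.X)⁻¹ (HahnSeries.single n (1 : ℂ) ⊗ₜ x, 0)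
      (HahnSeries.single m (1 : ℂ) ⊗ₜ y, 0) = killingForm ℂ g x y := by
  rcases le_or_gt (n + m) 0 with h | h
  · rw [formQ_geom_single n m h]
    simp
  · rw [formQ_apply, killingForm_laurent_tmul, killingForm_parabolicFiltration hk h hx hy]
    simp

theorem formQ_inclLoop (hk : highestCoeff b α = 1) {m m' : (ℂ[T;T⁻¹] ⊗[ℂ] g) × g}
    (hm : m ∈ orderSubalgebra b hk) (hm' : m' ∈ orderSubalgebra b hk) :
    formQ g (1 - PowerSeries.X)⁻¹ (inclLoop g m) (inclLoop g m') =
      formQbar g (evalOne g m) (evalOne g m') := by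
  rw [mem_orderSubalgebra] at hm hm'
  obtain ⟨z, x⟩ := m
  obtain ⟨z', x'⟩ := m'
  simp only at hm hm'
  set f := LinearMap.rTensor g (laurentEval laurentVar).toLinearMap with hf
  have hsplit : formQ g (1 - PowerSeries.X)⁻¹ (inclLoop g (z, x)) (inclLoop g (z', x')) =
      formQ g (1 - PowerSeries.X)⁻¹ (LinearMap.inl ℂ _ g (f z)) (LinearMap.inl ℂ _ g (f z')) -
        killingForm ℂ g x x' := by
    simp only [inclLoop_apply, formQ_apply, LinearMap.inl_apply, map_zero, sub_zero]
    rfl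
  rw [hsplit, formQbar_apply, evalOne_fst, evalOne_fst, evalOne_snd, evalOne_snd]
  congr 1
  obtain ⟨s, hs⟩ := exists_eq_sum_T_tmul z
  obtain ⟨s', hs'⟩ := exists_eq_sum_T_tmul z'
  have h1 := hs s subset_rfl
  have h2 := hs' s' subset_rfl
  rw [← hf] at h1 h2
  have e1 : f z = ∑ n ∈ s, HahnSeries.single n (1 : ℂ) ⊗ₜ loopCoeff g n (f z) := by
    conv_lhs => rw [h1, map_sum]
    exact Finset.sum_congr rfl fun n _ => rTensor_laurentVar_T_tmul _ _
  have e2 : f z' = ∑ n ∈ s', HahnSeries.single n (1 : ℂ) ⊗ₜ loopCoeff g n (f z') := by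
    conv_lhs => rw [h2, map_sum]
    exact Finset.sum_congr rfl fun n _ => rTensor_laurentVar_T_tmul _ _
  have v1 : TensorProduct.lid ℂ g (LinearMap.rTensor g (laurentEval (1 : ℂˣ)).toLinearMap z) =
      ∑ n ∈ s, loopCoeff g n (f z) := by
    conv_lhs => rw [h1, map_sum, map_sum]
    exact Finset.sum_congr rfl fun n _ => lid_evalOne_T_tmul _ _
  have v2 : TensorProduct.lid ℂ g (LinearMap.rTensor g (laurentEval (1 : ℂˣ)).toLinearMap z') =
      ∑ n ∈ s', loopCoeff g n (f z') := by
    conv_lhs => rw [h2, map_sum, map_sum]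
    exact Finset.sum_congr rfl fun n _ => lid_evalOne_T_tmul _ _
  simp only
  rw [v1, v2]
  conv_lhs => rw [e1, e2]
  simp only [map_sum, LinearMap.sum_apply]
  exact Finset.sum_congr rfl fun n _ => Finset.sum_congr rfl fun m _ =>
    formQ_geom_single_parabolicFiltration hk (hm _) (hm' _)

/-- Testing against (u^{1-n} - u^{-n})x, with x in filtration degree 1 - n, places the coefficient
of uⁿ in degree n of the filtration. Coefficients then vanish for n ≥ 2, so `q.1` is a Laurent
polynomial. -/
theorem exists_inclLoop_eq_of_orthogonal (hk : highestCoeff b α = 1)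
    (q : (LaurentSeries ℂ ⊗[ℂ] g) × g)
    (hq : ∀ m ∈ orderSubalgebra b hk, evalOne g m = 0 →
      formQ g (1 - PowerSeries.X)⁻¹ (inclLoop g m) q = 0) :
    ∃ m ∈ orderSubalgebra b hk, inclLoop g m = q := by
  have hmem : ∀ n, loopCoeff g n q.1 ∈ parabolicFiltration b α n := by
    intro n
    refine mem_parabolicFiltration_of_orthogonal hk fun x hx => ?_
    -- The term in u^{-n} needs x in filtration degree -n, which contains degree 1 - n.
    have hx' := parabolicFiltration_antitone (show 1 - n - 1 ≤ 1 - n by omega) hx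
    have h := hq ((LaurentPolynomial.T (1 - n) - LaurentPolynomial.T (1 - n - 1)) ⊗ₜ x, 0) ?_ ?_
    · have hincl : inclLoop g
          ((LaurentPolynomial.T (1 - n) - LaurentPolynomial.T (1 - n - 1)) ⊗ₜ x, 0) =
            ((HahnSeries.single (1 - n) (1 : ℂ) - HahnSeries.single (1 - n - 1) (1 : ℂ)) ⊗ₜ x, 0) := by
        rw [inclLoop_apply]
        simp only [TensorProduct.sub_tmul, map_sub, rTensor_laurentVar_T_tmul]
      rw [hincl, show q = (q.1, q.2) from rfl, formQ_geom_sub_single, neg_eq_zero,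
        killingForm_comm, sub_sub_cancel] at h
      exact h
    · rw [mem_orderSubalgebra]
      intro m
      simp only [TensorProduct.sub_tmul, map_sub, rTensor_laurentVar_T_tmul,
        loopCoeff_single_tmul]
      refine sub_mem ?_ ?_
      · split_ifs with h
        · rwa [h]
        · exact zero_mem _
      · split_ifs with h
        · rwa [h]
        · exact zero_mem _
    · refine Prod.ext ?_ rfl
      rw [evalOne_fst]
      simp only [TensorProduct.sub_tmul, map_sub, lid_evalOne_T_tmul, sub_self]
      rfl
  obtain ⟨w, p, hwp, hw⟩ := exists_eq_polynomial_add_powerSeries q.1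
  obtain ⟨v, hv⟩ : ∃ v, LinearMap.rTensor g (laurentEval laurentVar).toLinearMap v = q.1 := by
    refine ⟨w + (LaurentPolynomial.T 0 ⊗ₜ loopCoeff g 0 q.1 +
      LaurentPolynomial.T 1 ⊗ₜ loopCoeff g 1 q.1), ?_⟩
    refine ext_loopCoeff fun n => ?_
    simp only [map_add, rTensor_laurentVar_T_tmul, loopCoeff_single_tmul]
    rcases lt_or_ge n 0 with hn | hn
    · conv_rhs => rw [hwp]
      rw [map_add, loopCoeff_ofPowerSeries, if_pos hn, if_neg (by omega), if_neg (by omega)]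
      simp
    · rw [hw n hn]
      rcases le_or_gt 2 n with hn' | hn'
      · have := hmem n
        rw [parabolicFiltration_of_two_le hn', Submodule.mem_bot] at this
        rw [this, if_neg (by omega), if_neg (by omega)]
        simp
      · obtain rfl | rfl : n = 0 ∨ n = 1 := by omega
        · simp
        · simp
  refine ⟨(v, q.2), (mem_orderSubalgebra hk).mpr fun n => ?_, Prod.ext hv rfl⟩
  rw [hv]
  exact hmem n

theorem exists_evalOne_eq (hk : highestCoeff b α = 1) (y : g × g) :
    ∃ m ∈ orderSubalgebra b hk, evalOne g m = y := by
  -- Negative exponents carry no condition, so u⁻¹y.1 realises any value at u = 1.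
  refine ⟨(LaurentPolynomial.T (-1) ⊗ₜ y.1, y.2), ?_, Prod.ext ?_ rfl⟩
  · rw [mem_orderSubalgebra]
    intro n
    simp only [rTensor_laurentVar_T_tmul, loopCoeff_single_tmul]
    split_ifs with h
    · rw [h, parabolicFiltration_neg (by omega)]
      trivial
    · exact zero_mem _
  · exact lid_evalOne_T_tmul _ _

theorem exists_inclLoop_add_powerSeriesPart (hk : highestCoeff b α = 1)
    (q : (LaurentSeries ℂ ⊗[ℂ] g) × g) :
    ∃ m ∈ orderSubalgebra b hk, ∃ p ∈ powerSeriesPart g, inclLoop g m + p = q := by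
  obtain ⟨w, p, hwp, hw⟩ := exists_eq_polynomial_add_powerSeries q.1
  -- The polar part lies in the order without restriction, and the free component in `g` absorbs the
  -- constant term of the power series.
  refine ⟨(w, q.2 - TensorProduct.lid ℂ g (LinearMap.rTensor g (PowerSeries.coeff 0) p)), ?_,
    _, powerSeries_mem_powerSeriesPart p, Prod.ext hwp.symm ?_⟩
  · rw [mem_orderSubalgebra]
    intro n
    rcases lt_or_ge n 0 with hn | hn
    · rw [parabolicFiltration_neg hn]
      trivial
    · rw [hw n hn]
      exact zero_mem _
  · simp [inclLoop_apply]

theorem exists_of_mem_deltaSet (hk : highestCoeff b α = 1) {y : g × g} (hy : y ∈ deltaSet b α) :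
    ∃ m ∈ orderSubalgebra b hk, inclLoop g m ∈ powerSeriesPart g ∧ evalOne g m = y := by
  rw [mem_deltaSet_iff] at hy
  -- The linear polynomial with value y.2 at u = 0 and y.1 at u = 1.
  refine ⟨(LaurentPolynomial.T 0 ⊗ₜ y.2 + LaurentPolynomial.T 1 ⊗ₜ (y.1 - y.2), y.2), ?_, ?_,
    Prod.ext ?_ rfl⟩
  · rw [mem_orderSubalgebra]
    intro n
    simp only [map_add, rTensor_laurentVar_T_tmul, loopCoeff_single_tmul]
    refine add_mem ?_ ?_
    · split_ifs with h
      · rw [h, parabolicFiltration_zero]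
        simpa using sub_mem hy.1 (nilpotentPart_le_parabolic hy.2)
      · exact zero_mem _
    · split_ifs with h
      · rw [h, parabolicFiltration_one]
        exact hy.2
      · exact zero_mem _
  · rw [inclLoop_apply]
    simp only [map_add, rTensor_laurentVar_T_tmul]
    exact linear_mem_powerSeriesPart _ _
  · rw [evalOne_fst]
    simp only [map_add, lid_evalOne_T_tmul]
    abel

/-- Membership in `g[[u]]` removes negative degrees and the filtration removes degrees ≥ 2; the
component in `g` must equal the constant term. -/
theorem exists_eq_linear_of_mem_powerSeriesPart (hk : highestCoeff b α = 1)
    {m : (ℂ[T;T⁻¹] ⊗[ℂ] g) × g} (hm : m ∈ orderSubalgebra b hk)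
    (hP : inclLoop g m ∈ powerSeriesPart g) :
    ∃ x ∈ parabolic b α, ∃ y ∈ nilpotentPart b α,
      m = (LaurentPolynomial.T 0 ⊗ₜ x + LaurentPolynomial.T 1 ⊗ₜ y, x) := by
  rw [mem_orderSubalgebra] at hm
  obtain ⟨hneg, h0⟩ := mem_powerSeriesPart_coeff hP
  rw [inclLoop_apply] at hneg h0
  refine ⟨_, parabolicFiltration_zero (b := b) ▸ hm 0, _, parabolicFiltration_one (b := b) ▸ hm 1,
    Prod.ext (rTensor_laurentVar_injective (ext_loopCoeff fun n => ?_)) h0⟩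
  simp only [map_add, rTensor_laurentVar_T_tmul, loopCoeff_single_tmul]
  rcases lt_or_ge n 0 with hn | hn
  · rw [if_neg (by omega), if_neg (by omega), add_zero]
    exact hneg n hn
  · rcases le_or_gt 2 n with hn' | hn'
    · have := hm n
      rw [parabolicFiltration_of_two_le hn', Submodule.mem_bot] at this
      rw [this, if_neg (by omega), if_neg (by omega), add_zero]
    · obtain rfl | rfl : n = 0 ∨ n = 1 := by omega
      · simp
      · simp

theorem bijOn_specialize (hk : highestCoeff b α = 1) :
    Set.BijOn (specialize g) (loopLagrangians (1 - PowerSeries.X)⁻¹ b α)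
      (finiteLagrangians b α) := by
  have h := bijOn_lagrangian_reduction (S := orderSubalgebra b hk)
    (B := formQ g (1 - PowerSeries.X)⁻¹) (C := formQbar g) (P := powerSeriesPart g)
    (D := deltaSet b α) inclLoop_injective (fun m hm m' hm' => formQ_inclLoop hk hm hm')
    (exists_inclLoop_eq_of_orthogonal hk) (exists_evalOne_eq hk)
    (exists_inclLoop_add_powerSeriesPart hk) (fun y hy => exists_of_mem_deltaSet hk hy) ?_ ?_
  · rw [map_orderSubalgebra hk] at h
    exact h
  · intro m hm hP
    obtain ⟨x, hx, y, hy, rfl⟩ := exists_eq_linear_of_mem_powerSeriesPart hk hm hP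
    rw [mem_deltaSet_iff, evalOne_fst, evalOne_snd]
    simp only [map_add, lid_evalOne_T_tmul]
    refine ⟨add_mem hx (nilpotentPart_le_parabolic hy), ?_⟩
    rwa [add_sub_cancel_left]
  · intro m hm hP h0
    -- The value of (x + uy, x) at u = 1 is (x + y, x), which vanishes only for x = y = 0.
    obtain ⟨x, hx, y, hy, rfl⟩ := exists_eq_linear_of_mem_powerSeriesPart hk hm hP
    have h1 := congrArg Prod.fst h0
    have h2 : x = 0 := congrArg Prod.snd h0
    rw [evalOne_fst] at h1
    simp only [map_add, lid_evalOne_T_tmul, h2, zero_add] at h1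
    rw [h2, show y = 0 from h1]
    simp

end OrderSubalgebra

end PolyLie

end

theorem theorem3p3 {g : Type*} [LieRing g] [LieAlgebra ℂ g] [FiniteDimensional ℂ g]
    [LieAlgebra.IsSimple ℂ g] (H : LieSubalgebra ℂ g) [H.IsCartanSubalgebra]
    (b : (LieAlgebra.IsKilling.rootSystem H).Base) (α : b.support) :
    (PolyLie.highestCoeff b α = 1 →
      Set.BijOn (PolyLie.specialize g)
        (PolyLie.loopLagrangians (1 - PowerSeries.X)⁻¹ b α) (PolyLie.finiteLagrangians b α)) ∧
    (1 < PolyLie.highestCoeff b α →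
      PolyLie.loopLagrangians (1 - PowerSeries.X)⁻¹ b α = ∅) :=
  ⟨PolyLie.bijOn_specialize, PolyLie.loopLagrangians_eq_empty b α⟩
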